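/- Let $K$ be an algebraically closed field, let $Q$ be a finite quiver with vertices $1,\dots,n$, let $I$ be an admissible ideal of the path algebra $KQ$, and let $\Lambda = KQ/I$ (up to isomorphism, every basic finite dimensional $K$-algebra is of this form). Write $J$ for the Jacobson radical of $\Lambda$ and $e_1,\dots,e_n$ for the idempotents given by the vertices, and assume $J^2=0$. Modules are finitely generated left $\Lambda$-modules. The top of a module $M$ is $M/JM$, its dimension vector is $(\dim_K e_iM)_{1\le i\le n}$, and semisimple modules are considered up to isomorphism. For $\mathbf d=(d_1,\dots,d_n)\in\mathbb N_0^n$ let $\mathbf{Rep}_{\mathbf d}(\Lambda)$ be the affine variety of all families $(x_\alpha)$ of linear maps $x_\alpha\colon K^{d_i}\to K^{d_j}$, one for each arrow $\alpha\colon i\to j$ of $Q$, that satisfy all relations in $I$, with the Zariski topology. A point $x$ of it defines a $\Lambda$-module $M(x)$ on $\bigoplus_i K^{d_i}$. For a semisimple module $T$ let $\mathbf{Rep}^T_{\mathbf d}$ be the set of those points $x$ for which $M(x)$ has top $T$. Call $T$ a generic top of $\mathbf{Rep}_{\mathbf d}(\Lambda)$ if the closure of $\mathbf{Rep}^T_{\mathbf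 d}$ in $\mathbf{Rep}_{\mathbf d}(\Lambda)$ is an irreducible component of $\mathbf{Rep}_{\mathbf d}(\Lambda)$. Proposition. For every dimension vector $\mathbf d$ and every semisimple module $T$, the following statements are equivalent: (a) $T$ is a generic top of $\mathbf{Rep}_{\mathbf d}(\Lambda)$. (b) There exists a $\Lambda$-module $M$ with top $T$ and dimension vector $\mathbf d$ having the following property: whenever $M = M'\oplus S$ with $S$ simple, and $P'$ is a projective cover of $M'$, the semisimple module $JM\oplus S$ does not embed into $JP'$. -/

import Mathlib

universe u v w

noncomputable section

/-! ### The path algebra of a quiver -/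

section PathAlgebra

variable (K : Type u) [Field K] (V : Type v) [Quiver.{w} V]

/-- The path algebra `KQ`: the `K`-vector space whose basis is the set of all paths of the quiver,
including a trivial path (of length zero) at each vertex. -/
def PathAlgebra : Type (max u v w) :=
  (Σ a b : V, Quiver.Path a b) →₀ K

namespace PathAlgebra

instance : AddCommGroup (PathAlgebra K V) :=
  inferInstanceAs (AddCommGroup ((Σ a b : V, Quiver.Path a b) →₀ K))

instance : Module K (PathAlgebra K V) :=
  inferInstanceAs (Module K ((Σ a b : V, Quiver.Path a b) →₀ K))

variable {V}

/-- The basis element of `KQ` given by a path. -/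
def ofPath {a b : V} (p : Quiver.Path a b) : PathAlgebra K V :=
  Finsupp.single (⟨a, b, p⟩ : Σ a b : V, Quiver.Path a b) (1 : K)

variable {K}

theorem hom_ext {X : Type*} [AddCommGroup X] [Module K X] {f g : PathAlgebra K V →ₗ[K] X}
    (h : ∀ (a b : V) (p : Quiver.Path a b), f (ofPath K p) = g (ofPath K p)) : f = g :=
  Finsupp.lhom_ext' fun ⟨a, b, p⟩ => LinearMap.ext_ring (h a b p)

theorem induction_on {P : PathAlgebra K V → Prop} (x : PathAlgebra K V)
    (hz : P 0) (hadd : ∀ x y, P x → P y → P (x + y)) (hsmul : ∀ (c : K) x, P x → P (c • x))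
    (hpath : ∀ (a b : V) (p : Quiver.Path a b), P (ofPath K p)) : P x := by
  refine Finsupp.induction_linear (motive := P) x hz (fun f g hf hg => hadd f g hf hg) ?_
  rintro ⟨a, b, p⟩ c
  have h := hsmul c _ (hpath a b p)
  have e : c • ofPath K p = Finsupp.single (⟨a, b, p⟩ : Σ a b : V, Quiver.Path a b) c :=
    (Finsupp.smul_single c _ (1 : K)).trans (by rw [smul_eq_mul, mul_one])
  rwa [e] at h

variable (K)

/-- The linear map on `KQ` with prescribed values on the paths. -/
def lift {X : Type*} [AddCommGroup X] [Module K X]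
    (F : ∀ {a b : V}, Quiver.Path a b → X) : PathAlgebra K V →ₗ[K] X :=
  Finsupp.linearCombination K (fun p : (Σ a b : V, Quiver.Path a b) => F p.2.2)

@[simp]
theorem lift_ofPath {X : Type*} [AddCommGroup X] [Module K X]
    (F : ∀ {a b : V}, Quiver.Path a b → X) {a b : V} (p : Quiver.Path a b) :
    lift K F (ofPath K p) = F p := by
  unfold lift ofPath
  exact (Finsupp.linearCombination_single K _ _).trans (one_smul K _)

/-- The identity of `KQ` is the sum of the trivial paths. -/
instance [Fintype V] : One (PathAlgebra K V) :=
  ⟨∑ a : V, ofPath K (Quiver.Path.nil : Quiver.Path a a)⟩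

theorem one_def [Fintype V] :
    (1 : PathAlgebra K V) = ∑ a : V, ofPath K (Quiver.Path.nil : Quiver.Path a a) := rfl

variable [DecidableEq V]

/-- The product `p q` of two paths in `KQ`: "first `q`, then `p`" if `q` ends where `p` starts,
and zero otherwise. -/
def mulPath {c d a b : V} (p : Quiver.Path c d) (q : Quiver.Path a b) : PathAlgebra K V :=
  if h : b = c then ofPath K ((q.cast rfl h).comp p) else 0

/-- The bilinear multiplication of `KQ`. -/
def mulLin : PathAlgebra K V →ₗ[K] PathAlgebra K V →ₗ[K] PathAlgebra K V :=
  lift K fun p => lift K fun q => mulPath K p q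

instance : Mul (PathAlgebra K V) := ⟨fun x y => mulLin K x y⟩

theorem mul_def (x y : PathAlgebra K V) : x * y = mulLin K x y := rfl

theorem ofPath_mul_ofPath {c d a b : V} (p : Quiver.Path c d) (q : Quiver.Path a b) :
    ofPath K p * ofPath K q = mulPath K p q := by
  simp [mul_def, mulLin]

theorem ofPath_mul_ofPath_of_eq {a b c : V} (p : Quiver.Path b c) (q : Quiver.Path a b) :
    ofPath K p * ofPath K q = ofPath K (q.comp p) := by
  simp [ofPath_mul_ofPath, mulPath]

theorem ofPath_mul_ofPath_of_ne {a b c d : V} (p : Quiver.Path c d) (q : Quiver.Path a b)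
    (h : b ≠ c) : ofPath K p * ofPath K q = 0 := by
  simp [ofPath_mul_ofPath, mulPath, h]

theorem nil_mul_ofPath {a b : V} (c : V) (p : Quiver.Path a b) :
    ofPath K (Quiver.Path.nil : Quiver.Path c c) * ofPath K p =
      if b = c then ofPath K p else 0 := by
  split_ifs with h
  · subst h
    simp [ofPath_mul_ofPath_of_eq]
  · exact ofPath_mul_ofPath_of_ne K _ _ h

theorem ofPath_mul_nil {a b : V} (c : V) (p : Quiver.Path a b) :
    ofPath K p * ofPath K (Quiver.Path.nil : Quiver.Path c c) =
      if c = a then ofPath K p else 0 := by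
  split_ifs with h
  · subst h
    simp [ofPath_mul_ofPath_of_eq]
  · exact ofPath_mul_ofPath_of_ne K _ _ h

theorem mulPath_mul_assoc {a b a' b' a'' b'' : V} (p : Quiver.Path a b) (q : Quiver.Path a' b')
    (r : Quiver.Path a'' b'') :
    ofPath K p * ofPath K q * ofPath K r = ofPath K p * (ofPath K q * ofPath K r) := by
  by_cases h : b' = a
  · subst h
    by_cases h' : b'' = a'
    · subst h'
      simp [ofPath_mul_ofPath_of_eq, Quiver.Path.comp_assoc]
    · rw [ofPath_mul_ofPath_of_eq, ofPath_mul_ofPath_of_ne K _ _ h',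
        ofPath_mul_ofPath_of_ne K _ _ h']
      exact (map_zero (mulLin K (ofPath K p))).symm
  · rw [ofPath_mul_ofPath_of_ne K _ _ h]
    have h0 : (0 : PathAlgebra K V) * ofPath K r = 0 := by simp [mul_def]
    rw [h0]
    by_cases h' : b'' = a'
    · subst h'
      rw [ofPath_mul_ofPath_of_eq, ofPath_mul_ofPath_of_ne K _ _ h]
    · rw [ofPath_mul_ofPath_of_ne K _ _ h']
      exact (map_zero (mulLin K (ofPath K p))).symm

theorem mulLin_assoc (x y z : PathAlgebra K V) :
    mulLin K (mulLin K x y) z = mulLin K x (mulLin K y z) := by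
  induction x using induction_on with
  | hz => simp
  | hadd x x' h h' => simp [h, h']
  | hsmul c x h => simp [h]
  | hpath a b p =>
    induction y using induction_on with
    | hz => simp
    | hadd x x' h h' => simp [h, h']
    | hsmul c x h => simp [h]
    | hpath a' b' q =>
      induction z using induction_on with
      | hz => simp
      | hadd x x' h h' => simp [h, h']
      | hsmul c x h => simp [h]
      | hpath a'' b'' r => exact mulPath_mul_assoc K p q r

variable [Fintype V]

theorem one_mulLin (x : PathAlgebra K V) : mulLin K 1 x = x := by
  induction x using induction_on with
  | hz => simp
  | hadd x x' h h' => simp [h, h']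
  | hsmul c x h => simp [h]
  | hpath a b p =>
    have h : ∀ c : V, mulLin K (ofPath K (Quiver.Path.nil : Quiver.Path c c)) (ofPath K p) =
      if b = c then ofPath K p else 0 := fun c => nil_mul_ofPath K c p
    simp [one_def, h]

theorem mulLin_one (x : PathAlgebra K V) : mulLin K x 1 = x := by
  induction x using induction_on with
  | hz => simp
  | hadd x x' h h' => simp [h, h']
  | hsmul c x h => simp [h]
  | hpath a b p =>
    have h : ∀ c : V, mulLin K (ofPath K p) (ofPath K (Quiver.Path.nil : Quiver.Path c c)) =
      if c = a then ofPath K p else 0 := fun c => ofPath_mul_nil K c p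
    simp [one_def, h]

instance : Ring (PathAlgebra K V) :=
  { (inferInstance : AddCommGroup (PathAlgebra K V)) with
    mul := fun x y => x * y
    one := 1
    mul_assoc := mulLin_assoc K
    one_mul := one_mulLin K
    mul_one := mulLin_one K
    left_distrib := fun x y z => map_add (mulLin K x) y z
    right_distrib := fun x y z => by simp [mul_def]
    zero_mul := fun x => by simp [mul_def]
    mul_zero := fun x => map_zero (mulLin K x) }

instance : Algebra K (PathAlgebra K V) :=
  Algebra.ofModule (fun c x y => by simp [mul_def]) (fun c x y => by simp [mul_def])

/-- The subspace of `KQ` spanned by the paths of length at least `m`; this is the `m`-th power of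
the ideal generated by the arrows. -/
def arrowPower (m : ℕ) : Submodule K (PathAlgebra K V) :=
  Submodule.span K {x | ∃ (a b : V) (p : Quiver.Path a b), m ≤ p.length ∧ x = ofPath K p}

variable {K}

/-- A (two-sided) ideal `I` of `KQ` is admissible if it contains all sufficiently long paths and is
contained in the square of the arrow ideal. -/
def IsAdmissible (I : Ideal (PathAlgebra K V)) : Prop :=
  I.IsTwoSided ∧ (∃ m : ℕ, arrowPower K m ≤ I.restrictScalars K) ∧
    I.restrictScalars K ≤ arrowPower K 2

end PathAlgebra

end PathAlgebra

/-! ### Modules: tops, dimension vectors, projective covers -/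

section Modules

/-- The radical `JM` of a left `Λ`-module `M`, where `J` is the Jacobson radical of `Λ`. -/
def radModule (Λ : Type*) [Ring Λ] (M : Type*) [AddCommGroup M] [Module Λ M] : Submodule Λ M :=
  Ring.jacobson Λ • (⊤ : Submodule Λ M)

/-- `M` has top `T`, that is, `M / JM ≅ T`. -/
def HasTop (Λ : Type*) [Ring Λ] (M : Type*) [AddCommGroup M] [Module Λ M]
    (T : Type*) [AddCommGroup T] [Module Λ T] : Prop :=
  Nonempty ((M ⧸ radModule Λ M) ≃ₗ[Λ] T)

/-- `f : P → M` is a projective cover: `P` is projective, `f` is surjective and its kernel is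
superfluous. -/
structure IsProjectiveCover {Λ : Type*} [Ring Λ] {P : Type*} [AddCommGroup P] [Module Λ P]
    {M : Type*} [AddCommGroup M] [Module Λ M] (f : P →ₗ[Λ] M) : Prop where
  projective : Module.Projective Λ P
  surjective : Function.Surjective f
  superfluous : ∀ N : Submodule Λ P, N ⊔ LinearMap.ker f = ⊤ → N = ⊤

/-- `X` embeds into `Y` as a `Λ`-module. -/
def EmbedsInto (Λ : Type*) [Ring Λ] (X : Type*) [AddCommGroup X] [Module Λ X]
    (Y : Type*) [AddCommGroup Y] [Module Λ Y] : Prop :=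
  ∃ f : X →ₗ[Λ] Y, Function.Injective f

end Modules

/-! ### Algebras `Λ = KQ / I` and the varieties of their modules -/

section Rep

/-- The affine space `K^σ` with its Zariski topology: the closed sets are the zero loci of sets of
polynomials. -/
@[reducible]
def zariskiTopology (K : Type*) [Field K] (σ : Type*) : TopologicalSpace (σ → K) :=
  TopologicalSpace.ofClosed
    {Z | ∃ E : Set (MvPolynomial σ K), Z = {x | ∀ p ∈ E, MvPolynomial.eval x p = 0}}
    ⟨{1}, by ext x; simp⟩
    (by
      intro A hA
      refine ⟨{p | ∀ x ∈ ⋂₀ A, MvPolynomial.eval x p = 0}, Set.Subset.antisymm ?_ ?_⟩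
      · intro x hx p hp
        exact hp x hx
      · intro x hx Z hZ
        obtain ⟨E, hE⟩ := hA hZ
        rw [hE]
        intro p hp
        refine hx p fun y hy => ?_
        have hyZ := hy Z hZ
        rw [hE] at hyZ
        exact hyZ p hp)
    (by
      rintro _ ⟨E, rfl⟩ _ ⟨F, rfl⟩
      refine ⟨{r | ∃ p ∈ E, ∃ q ∈ F, r = p * q}, Set.Subset.antisymm ?_ ?_⟩
      · rintro x (hx | hx) _ ⟨p, hp, q, hq, rfl⟩
        · simp [hx p hp]
        · simp [hx q hq]
      · intro x hx
        by_contra hne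
        simp only [Set.mem_union, Set.mem_ofPred_eq, not_or, not_forall] at hne
        obtain ⟨⟨p, hp, hp0⟩, ⟨q, hq, hq0⟩⟩ := hne
        have h0 := hx (p * q) ⟨p, hp, q, hq, rfl⟩
        rw [map_mul] at h0
        exact (mul_ne_zero hp0 hq0) h0)

variable {K : Type u} [Field K] {V : Type v} [Quiver.{w} V]

/-- The points `(x_α)` of the affine space `∏_α Hom_K(K^{d_start(α)}, K^{d_end(α)})`, written as
families of matrices, where `α` ranges over the arrows of the quiver. -/
abbrev RepSpace (K : Type u) (d : V → ℕ) : Type (max u v w) :=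
  ∀ ⦃a b : V⦄, (a ⟶ b) → Matrix (Fin (d b)) (Fin (d a)) K

/-- The coordinates of a point of `RepSpace K d`: all entries of all its matrices. -/
def RepSpace.coords {d : V → ℕ} (x : RepSpace K d) :
    (Σ a b : V, (a ⟶ b) × Fin (d b) × Fin (d a)) → K :=
  fun s => x s.2.2.1 s.2.2.2.1 s.2.2.2.2

/-- The vector space `⨁_i K^{d_i}`, where `i` ranges over the (finitely many) vertices. -/
abbrev VecSpace (K : Type u) (d : V → ℕ) : Type (max u v) := ∀ a : V, Fin (d a) → K

/-- The linear map `K^{d_a} → K^{d_b}` given by a path from `a` to `b`: the composition of the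
maps given by its arrows. -/
def pathMap {d : V → ℕ} (x : RepSpace K d) {a : V} :
    ∀ {b : V}, Quiver.Path a b → ((Fin (d a) → K) →ₗ[K] (Fin (d b) → K))
  | _, .nil => LinearMap.id
  | _, .cons p α => Matrix.mulVecLin (x α) ∘ₗ pathMap x p

theorem pathMap_comp {d : V → ℕ} (x : RepSpace K d) {a b c : V} (q : Quiver.Path a b)
    (p : Quiver.Path b c) : pathMap x (q.comp p) = pathMap x p ∘ₗ pathMap x q := by
  induction p with
  | nil => rfl
  | cons p α ih => simp [pathMap, ih, LinearMap.comp_assoc]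

variable [Fintype V] [DecidableEq V]

/-- The endomorphism of `⨁_i K^{d_i}` given by a path from `a` to `b`: it is the map of the path on
`K^{d_a}` (with values in `K^{d_b}`) and zero on the other summands. -/
def pathEnd {d : V → ℕ} (x : RepSpace K d) {a b : V} (p : Quiver.Path a b) :
    Module.End K (VecSpace K d) :=
  LinearMap.single K (fun i : V => Fin (d i) → K) b ∘ₗ pathMap x p ∘ₗ LinearMap.proj a

theorem lift_pathEnd_mul {d : V → ℕ} (x : RepSpace K d) (r s : PathAlgebra K V) :
    PathAlgebra.lift K (pathEnd x) (r * s) =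
      PathAlgebra.lift K (pathEnd x) r * PathAlgebra.lift K (pathEnd x) s := by
  induction r using PathAlgebra.induction_on with
  | hz => simp
  | hadd r r' h h' => simp [add_mul, h, h']
  | hsmul c r h => simp [h]
  | hpath a b p =>
    induction s using PathAlgebra.induction_on with
    | hz => simp
    | hadd s s' h h' => simp [mul_add, h, h']
    | hsmul c s h => simp [h]
    | hpath a' b' q =>
      by_cases h : b' = a
      · subst h
        rw [PathAlgebra.ofPath_mul_ofPath_of_eq]
        refine LinearMap.ext fun m => ?_
        simp [pathEnd, pathMap_comp]
      · rw [PathAlgebra.ofPath_mul_ofPath_of_ne K _ _ h]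
        refine LinearMap.ext fun m => ?_
        simp [pathEnd, Pi.single_eq_of_ne (Ne.symm h)]

theorem lift_pathEnd_one {d : V → ℕ} (x : RepSpace K d) :
    PathAlgebra.lift K (pathEnd x) 1 = 1 := by
  refine LinearMap.ext fun m => ?_
  have h : (∑ a : V, Pi.single a (m a) : VecSpace K d) = m := Finset.univ_sum_single m
  simpa [PathAlgebra.one_def, pathEnd, pathMap] using h

/-- The action of `KQ` on `⨁_i K^{d_i}` given by a point `x`. -/
def evalRep {d : V → ℕ} (x : RepSpace K d) : PathAlgebra K V →ₐ[K] Module.End K (VecSpace K d) :=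
  AlgHom.ofLinearMap (PathAlgebra.lift K (pathEnd x)) (lift_pathEnd_one x) (lift_pathEnd_mul x)

variable {Λ : Type*} [Ring Λ] [Algebra K Λ]

/-- A presentation `Λ ≅ KQ / I` with an admissible ideal `I`, given by the surjection `KQ → Λ`
with kernel `I`. -/
structure AdmissiblePresentation (K : Type u) [Field K] (V : Type v) [Quiver.{w} V] [Fintype V]
    [DecidableEq V] (Λ : Type*) [Ring Λ] [Algebra K Λ] where
  /-- the surjection from the path algebra -/
  toAlgHom : PathAlgebra K V →ₐ[K] Λ
  surjective : Function.Surjective toAlgHom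
  admissible : PathAlgebra.IsAdmissible (RingHom.ker toAlgHom)

namespace AdmissiblePresentation

/-- The primitive idempotent `e_a` of `Λ` belonging to the vertex `a`. -/
def idem (π : AdmissiblePresentation K V Λ) (a : V) : Λ :=
  π.toAlgHom (PathAlgebra.ofPath K (Quiver.Path.nil : Quiver.Path a a))

/-- The dimension vector of a `Λ`-module `M`: its entry at the vertex `a` is `dim_K (e_a M)`. -/
def dimVec (π : AdmissiblePresentation K V Λ) (M : Type*) [AddCommGroup M] [Module K M]
    [Module Λ M] [IsScalarTower K Λ M] (a : V) : ℕ :=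
  Module.finrank K (LinearMap.range (Algebra.lsmul K K M (π.idem a)))

/-- The variety `Rep_d(Λ)`: the points `(x_α)` that satisfy all the relations in `I`. -/
def RepVariety (π : AdmissiblePresentation K V Λ) (d : V → ℕ) : Type (max u v w) :=
  {x : RepSpace K d // ∀ r ∈ RingHom.ker π.toAlgHom, evalRep x r = 0}

/-- The Zariski topology on `Rep_d(Λ)`, as a subset of affine space. -/
instance (π : AdmissiblePresentation K V Λ) (d : V → ℕ) : TopologicalSpace (π.RepVariety d) :=
  TopologicalSpace.induced (fun x => RepSpace.coords x.1) (zariskiTopology K _)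

/-- The action of `Λ` on `⨁_i K^{d_i}` given by a point of `Rep_d(Λ)`. -/
def action (π : AdmissiblePresentation K V Λ) {d : V → ℕ} (x : π.RepVariety d) :
    Λ →+* Module.End K (VecSpace K d) :=
  RingHom.liftOfSurjective (π.toAlgHom : PathAlgebra K V →+* Λ) π.surjective
    ⟨(evalRep x.1 : PathAlgebra K V →+* Module.End K (VecSpace K d)), fun r hr => x.2 r hr⟩

theorem action_apply (π : AdmissiblePresentation K V Λ) {d : V → ℕ} (x : π.RepVariety d)
    (r : PathAlgebra K V) : π.action x (π.toAlgHom r) = evalRep x.1 r :=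
  RingHom.liftOfRightInverse_comp_apply (π.toAlgHom : PathAlgebra K V →+* Λ) _
    (Function.rightInverse_surjInv π.surjective)
    ⟨(evalRep x.1 : PathAlgebra K V →+* Module.End K (VecSpace K d)), fun r hr => x.2 r hr⟩ r

/-- The `Λ`-module `M(x)` belonging to a point `x` of `Rep_d(Λ)`. Its underlying vector space is
`⨁_i K^{d_i}`. -/
def RepModule (π : AdmissiblePresentation K V Λ) {d : V → ℕ} (_x : π.RepVariety d) :
    Type (max u v) :=
  VecSpace K d

instance (π : AdmissiblePresentation K V Λ) {d : V → ℕ} (x : π.RepVariety d) :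
    AddCommGroup (π.RepModule x) :=
  inferInstanceAs (AddCommGroup (VecSpace K d))

instance (π : AdmissiblePresentation K V Λ) {d : V → ℕ} (x : π.RepVariety d) :
    Module Λ (π.RepModule x) :=
  Module.compHom (VecSpace K d) (π.action x)

/-- The subset `Rep_d^T` of `Rep_d(Λ)`: the points `x` such that `M(x)` has top `T`. -/
def repTop (π : AdmissiblePresentation K V Λ) (d : V → ℕ) (T : Type*) [AddCommGroup T]
    [Module Λ T] : Set (π.RepVariety d) :=
  {x | HasTop Λ (π.RepModule x) T}

/-- `T` is a generic top of `Rep_d(Λ)`: the closure of `Rep_d^T` is an irreducible component of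
`Rep_d(Λ)`. -/
def IsGenericTop (π : AdmissiblePresentation K V Λ) (d : V → ℕ) (T : Type*) [AddCommGroup T]
    [Module Λ T] : Prop :=
  closure (π.repTop d T) ∈ irreducibleComponents (π.RepVariety d)

end AdmissiblePresentation

end Rep

end

-- Since `J ^ 2 = 0`, the points of `Rep_d(Λ)` are exactly the families of matrices in which
-- consecutive arrows compose to zero. At a point `x`, the space `imSpace b` is `e_b J M(x)` and
-- lies in `socSpace b`; a simple summand at `b` splits off exactly when this inclusion is proper.
-- Semisimple modules are determined by their dimension vectors, and the top and the radical of
-- `M(x)` together have dimension vector `d`. Hence a nonempty `Rep_d^T` is a `stratum`: the radical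
-- has a fixed dimension vector `s`. There are finitely many nonempty strata, each of them
-- irreducible (`isPreirreducible_stratum`), so the question is which closures of strata are
-- maximal.
--
-- Condition (b) is numerical as well (`forall_not_embedsInto_iff`). If `S` sits at the vertex `v`,
-- then `P'` has top of dimension vector `d - s - δ_v`, and `e_b J P'` has as dimension the number
-- of arrows into `b`, weighted by that top. So `J M ⊕ S` embeds into `J P'` exactly when `HasRoom d
-- s v`.
--
-- If a point `x` of stratum `s` lies in the closure of stratum `s' ≠ s`, semicontinuity gives `s ≤
-- s'` and bounds `s'` by the dimensions of the socle spaces of `x`. At a vertex `v` with `s v < s'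
-- v` a simple summand therefore splits off, and there is room for it because `s'` is the radical
-- vector of an actual module. Conversely, if every point of the stratum has a simple summand with
-- room, irreducibility provides one vertex `v` that serves all points, and an explicit deformation
-- (`mem_closure_stratum`) places the stratum in the closure of stratum `s + δ_v`, which is strictly
-- larger. Both directions meet in `closure_stratum_mem_irreducibleComponents_iff`.

universe u₁

/-! ### The algebra: idempotents, arrows and the radical. -/

noncomputable section

namespace PathAlgebra

variable {K : Type u} [Field K] {V : Type v} [Quiver.{w} V]

theorem ofPath_mem_arrowPower [Fintype V] [DecidableEq V] {a b : V} (p : Quiver.Path a b) {m : ℕ}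
    (h : m ≤ p.length) : ofPath K p ∈ arrowPower K (V := V) m :=
  Submodule.subset_span ⟨a, b, p, h, rfl⟩

theorem mul_mem_arrowPower [Fintype V] [DecidableEq V] {i j : ℕ} {x y : PathAlgebra K V}
    (hx : x ∈ arrowPower K i) (hy : y ∈ arrowPower K j) : x * y ∈ arrowPower K (i + j) := by
  induction hx using Submodule.span_induction with
  | zero => rw [zero_mul]; exact zero_mem _
  | add x x' _ _ h h' => rw [add_mul]; exact add_mem h h'
  | smul c x _ h => rw [smul_mul_assoc]; exact Submodule.smul_mem _ _ h
  | mem x hx =>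
    obtain ⟨a, b, p, hp, rfl⟩ := hx
    induction hy using Submodule.span_induction with
    | zero => rw [mul_zero]; exact zero_mem _
    | add x x' _ _ h h' => rw [mul_add]; exact add_mem h h'
    | smul c x _ h => rw [mul_smul_comm]; exact Submodule.smul_mem _ _ h
    | mem y hy =>
      obtain ⟨c, d, q, hq, rfl⟩ := hy
      by_cases h : d = a
      · subst h
        rw [ofPath_mul_ofPath_of_eq]
        refine ofPath_mem_arrowPower _ ?_
        rw [Quiver.Path.length_comp]; omega
      · rw [ofPath_mul_ofPath_of_ne K _ _ h]; exact zero_mem _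

theorem mem_arrowPower_zero [Fintype V] [DecidableEq V] (x : PathAlgebra K V) :
    x ∈ arrowPower K (V := V) 0 := by
  induction x using induction_on with
  | hz => exact zero_mem _
  | hadd x y hx hy => exact add_mem hx hy
  | hsmul c x hx => exact Submodule.smul_mem _ _ hx
  | hpath a b p => exact ofPath_mem_arrowPower p (Nat.zero_le _)

/-- The coefficient of a path in an element of the path algebra. -/
def coeff (s : Σ a b : V, Quiver.Path a b) : PathAlgebra K V →ₗ[K] K :=
  Finsupp.lapply s

theorem coeff_ofPath [DecidableEq (Σ a b : V, Quiver.Path a b)]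
    (s : Σ a b : V, Quiver.Path a b) {a b : V} (p : Quiver.Path a b) :
    coeff s (ofPath K p) = if (⟨a, b, p⟩ : Σ a b : V, Quiver.Path a b) = s then 1 else 0 := by
  unfold coeff ofPath
  exact Finsupp.single_apply

/-- Paths form a basis, so a combination of long paths has no component along a short one. As `I`
lies in the square of the arrow ideal, this keeps vertices and arrows independent in `Λ`. -/
theorem coeff_eq_zero_of_mem_arrowPower [Fintype V] [DecidableEq V] {m : ℕ} {x : PathAlgebra K V}
    (hx : x ∈ arrowPower K m) (s : Σ a b : V, Quiver.Path a b) (hs : s.2.2.length < m) :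
    coeff s x = 0 := by
  classical
  induction hx using Submodule.span_induction with
  | zero => exact map_zero _
  | add x x' _ _ h h' => rw [map_add, h, h', add_zero]
  | smul c x _ h => rw [map_smul, h, smul_zero]
  | mem x hx =>
    obtain ⟨a, b, p, hp, rfl⟩ := hx
    rw [coeff_ofPath, if_neg]
    rintro rfl
    exact absurd hs (by simpa using hp)

end PathAlgebra

namespace AdmissiblePresentation

open PathAlgebra

variable {K : Type u} [Field K] {V : Type v} [Quiver.{w} V] [Fintype V] [DecidableEq V]
  {Λ : Type*} [Ring Λ] [Algebra K Λ] (π : AdmissiblePresentation K V Λ)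

/-- The element of `Λ` given by an arrow. -/
def arrow {a b : V} (α : a ⟶ b) : Λ := π.toAlgHom (ofPath K α.toPath)

theorem idem_mul_idem_self (a : V) : π.idem a * π.idem a = π.idem a := by
  rw [idem, ← map_mul, nil_mul_ofPath, if_pos rfl]

theorem idem_mul_idem_of_ne {a b : V} (h : a ≠ b) : π.idem a * π.idem b = 0 := by
  rw [idem, idem, ← map_mul, nil_mul_ofPath, if_neg h.symm, map_zero]

theorem sum_idem : ∑ a, π.idem a = 1 := by
  simp only [idem]
  rw [← map_sum, ← one_def, map_one]

theorem idem_mul_arrow {a b : V} (α : a ⟶ b) : π.idem b * π.arrow α = π.arrow α := by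
  rw [idem, arrow, ← map_mul, nil_mul_ofPath, if_pos rfl]

theorem idem_mul_arrow_of_ne {a b c : V} (h : c ≠ b) (α : a ⟶ b) :
    π.idem c * π.arrow α = 0 := by
  rw [← idem_mul_arrow, ← mul_assoc, idem_mul_idem_of_ne _ h, zero_mul]

theorem arrow_mul_idem {a b : V} (α : a ⟶ b) : π.arrow α * π.idem a = π.arrow α := by
  rw [idem, arrow, ← map_mul, ofPath_mul_nil, if_pos rfl]

theorem mem_arrowPower_two_of_map_eq_zero {r : PathAlgebra K V} (h : π.toAlgHom r = 0) :
    r ∈ arrowPower K (V := V) 2 :=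
  π.admissible.2.2 (show r ∈ RingHom.ker π.toAlgHom from h)

theorem idem_ne_zero (a : V) : π.idem a ≠ 0 := by
  classical
  intro h
  have h1 := coeff_eq_zero_of_mem_arrowPower (π.mem_arrowPower_two_of_map_eq_zero h)
    ⟨a, a, Quiver.Path.nil⟩ (by simp)
  rw [coeff_ofPath, if_pos rfl] at h1
  exact one_ne_zero h1

theorem linearIndependent_arrow :
    LinearIndependent K fun s : (Σ a b : V, a ⟶ b) => π.arrow s.2.2 := by
  classical
  rw [linearIndependent_iff']
  intro S g hg s hs
  have h : π.toAlgHom (∑ t ∈ S, g t • ofPath K t.2.2.toPath) = 0 := by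
    rw [map_sum, ← hg]
    exact Finset.sum_congr rfl fun t _ => by rw [map_smul, arrow]
  have h1 := coeff_eq_zero_of_mem_arrowPower (π.mem_arrowPower_two_of_map_eq_zero h)
    ⟨s.1, s.2.1, s.2.2.toPath⟩ (by simp)
  rw [map_sum, Finset.sum_eq_single s] at h1
  · simpa [coeff_ofPath] using h1
  · rintro ⟨a, b, α⟩ _ hne
    obtain ⟨a', b', β⟩ := s
    rw [map_smul, coeff_ofPath, if_neg, smul_zero]
    intro heq
    apply hne
    obtain rfl : a = a' := congrArg Sigma.fst heq
    have h2 := eq_of_heq (Sigma.mk.inj heq).2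
    obtain rfl : b = b' := congrArg Sigma.fst h2
    have h3 := eq_of_heq (Sigma.mk.inj h2).2
    have h4 : (Quiver.Path.nil.cons α : Quiver.Path a b) = Quiver.Path.nil.cons β := h3
    cases h4
    rfl
  · exact fun h => absurd hs h

/-- A left multiple of an arrow comes from the arrow ideal, hence is nilpotent because `I` contains
all long paths; so one plus it is invertible. -/
theorem arrow_mem_jacobson {a b : V} (α : a ⟶ b) : π.arrow α ∈ Ring.jacobson Λ := by
  have hbot : Ring.jacobson Λ = (⊥ : Ideal Λ).jacobson := by
    simp [Ring.jacobson_eq_sInf_isMaximal, Ideal.jacobson]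
  rw [hbot, Ideal.mem_jacobson_iff]
  intro y
  obtain ⟨r, rfl⟩ := π.surjective y
  obtain ⟨m, hm⟩ := π.admissible.2.1
  set n : PathAlgebra K V := r * ofPath K α.toPath with hn
  have hn1 : n ∈ arrowPower K (V := V) 1 := by
    have := mul_mem_arrowPower (mem_arrowPower_zero r)
      (ofPath_mem_arrowPower (K := K) α.toPath (m := 1) (by simp))
    simpa using this
  have hpow : ∀ k : ℕ, n ^ k ∈ arrowPower K (V := V) k := by
    intro k
    induction k with
    | zero => exact mem_arrowPower_zero _
    | succ k ih => rw [pow_succ]; exact mul_mem_arrowPower ih hn1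
  have hnil : IsNilpotent (π.toAlgHom n) :=
    ⟨m, by rw [← map_pow]; exact hm (hpow m)⟩
  obtain ⟨z, hz⟩ := hnil.isUnit_one_add.exists_left_inv
  refine ⟨z, ?_⟩
  have : z * π.toAlgHom r * π.arrow α = z * π.toAlgHom n := by
    rw [hn, map_mul, mul_assoc, arrow]
  rw [this, Ideal.mem_bot, ← hz]
  noncomm_ring

variable (hJ : Ring.jacobson Λ ^ 2 = ⊥)
include hJ in
theorem mul_eq_zero_of_mem_jacobson {x y : Λ} (hx : x ∈ Ring.jacobson Λ)
    (hy : y ∈ Ring.jacobson Λ) : x * y = 0 := by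
  have := Ideal.mul_mem_mul hx hy
  have h2 : Ring.jacobson Λ * Ring.jacobson Λ = ⊥ := by
    rw [← hJ, Submodule.pow_succ, Submodule.pow_one]
  rwa [h2, Ideal.mem_bot] at this

include hJ in
theorem arrow_mul_arrow {a b c d : V} (α : a ⟶ b) (β : c ⟶ d) : π.arrow α * π.arrow β = 0 :=
  mul_eq_zero_of_mem_jacobson hJ (π.arrow_mem_jacobson α) (π.arrow_mem_jacobson β)

include hJ in
theorem map_ofPath_eq_zero {a b : V} (p : Quiver.Path a b) (hp : 2 ≤ p.length) :
    π.toAlgHom (ofPath K p) = 0 := by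
  cases p with
  | nil => simp at hp
  | cons p α =>
    cases p with
    | nil => simp at hp
    | cons p β =>
      have : ofPath K ((p.cons β).cons α) =
          ofPath K α.toPath * (ofPath K β.toPath * ofPath K p) := by
        rw [ofPath_mul_ofPath_of_eq, ofPath_mul_ofPath_of_eq]; rfl
      rw [this, ← mul_assoc, map_mul, map_mul]
      have h := π.arrow_mul_arrow hJ α β
      rw [arrow, arrow] at h
      rw [h, zero_mul]

include hJ in
/-- Every element of `Λ` is a linear combination of vertex idempotents and arrows. -/
theorem induction_generators {P : Λ → Prop} (hadd : ∀ x y, P x → P y → P (x + y))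
    (hsmul : ∀ (c : K) x, P x → P (c • x)) (hidem : ∀ a, P (π.idem a))
    (harrow : ∀ (a b : V) (α : a ⟶ b), P (π.arrow α)) (hz : P 0) (x : Λ) : P x := by
  obtain ⟨r, rfl⟩ := π.surjective x
  induction r using PathAlgebra.induction_on with
  | hz => rwa [map_zero]
  | hadd x y hx hy => rw [map_add]; exact hadd _ _ hx hy
  | hsmul c x hx => rw [map_smul]; exact hsmul _ _ hx
  | hpath a b p =>
    cases p with
    | nil => exact hidem a
    | cons p α =>
      cases p with
      | nil => exact harrow _ _ α
      | cons p β => rw [π.map_ofPath_eq_zero hJ _ (by simp)]; exact hz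

/-- The `K`-span of the arrows in `Λ`. -/
def arrowSpan : Submodule K Λ := Submodule.span K {x | ∃ (a b : V) (α : a ⟶ b), x = π.arrow α}

theorem arrow_mem_arrowSpan {a b : V} (α : a ⟶ b) : π.arrow α ∈ π.arrowSpan :=
  Submodule.subset_span ⟨a, b, α, rfl⟩

theorem arrowSpan_le : π.arrowSpan ≤ (Ring.jacobson Λ).restrictScalars K :=
  Submodule.span_le.2 <| by rintro _ ⟨a, b, α, rfl⟩; exact π.arrow_mem_jacobson α

include hJ in
theorem exists_eq_sum_idem_add (x : Λ) :
    ∃ (c : V → K) (y : Λ), y ∈ π.arrowSpan ∧ x = ∑ a, c a • π.idem a + y := by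
  classical
  induction x using π.induction_generators hJ with
  | hz => exact ⟨0, 0, zero_mem _, by simp⟩
  | hadd x x' h h' =>
    obtain ⟨c, y, hy, rfl⟩ := h
    obtain ⟨c', y', hy', rfl⟩ := h'
    refine ⟨c + c', y + y', add_mem hy hy', ?_⟩
    simp only [Pi.add_apply, add_smul, Finset.sum_add_distrib]
    abel
  | hsmul k x h =>
    obtain ⟨c, y, hy, rfl⟩ := h
    refine ⟨k • c, k • y, Submodule.smul_mem _ _ hy, ?_⟩
    simp [smul_add, Finset.smul_sum, mul_smul]
  | hidem a => exact ⟨Pi.single a 1, 0, zero_mem _, by simp [Pi.single_apply, ite_smul]⟩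
  | harrow a b α => exact ⟨0, π.arrow α, π.arrow_mem_arrowSpan α, by simp⟩

include hJ in
-- For an element of `J`, removing the arrow part and multiplying by `e_b` leaves `c_b e_b` in `J`;
-- its square vanishes, which forces `c_b = 0`.
theorem mem_jacobson_iff (x : Λ) : x ∈ Ring.jacobson Λ ↔ x ∈ π.arrowSpan := by
  refine ⟨fun hx => ?_, fun hx => π.arrowSpan_le hx⟩
  obtain ⟨c, y, hy, rfl⟩ := π.exists_eq_sum_idem_add hJ x
  have hs : ∑ a, c a • π.idem a ∈ Ring.jacobson Λ := by
    have := sub_mem hx (π.arrowSpan_le hy : y ∈ Ring.jacobson Λ)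
    rwa [add_sub_cancel_right] at this
  have hc : ∀ b, c b = 0 := by
    intro b
    have h1 : c b • π.idem b ∈ Ring.jacobson Λ := by
      have := Ideal.mul_mem_left _ (π.idem b) hs
      rw [Finset.mul_sum, Finset.sum_eq_single b] at this
      · rwa [mul_smul_comm, idem_mul_idem_self] at this
      · intro a _ hab
        rw [mul_smul_comm, idem_mul_idem_of_ne _ hab.symm, smul_zero]
      · simp
    have h2 := mul_eq_zero_of_mem_jacobson hJ h1 h1
    rw [smul_mul_smul_comm, idem_mul_idem_self] at h2
    rcases smul_eq_zero.1 h2 with h | h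
    · exact mul_self_eq_zero.1 h
    · exact absurd h (π.idem_ne_zero b)
  simpa [hc] using hy

include π hJ in
theorem module_finite [∀ a b : V, Finite (a ⟶ b)] : Module.Finite K Λ := by
  classical
  have hfin : (Set.range π.idem ∪ Set.range fun s : (Σ a b : V, a ⟶ b) => π.arrow s.2.2).Finite :=
    (Set.finite_range _).union (Set.finite_range _)
  refine ⟨⟨hfin.toFinset, ?_⟩⟩
  rw [Set.Finite.coe_toFinset, eq_top_iff]
  rintro x -
  induction x using π.induction_generators hJ with
  | hz => exact zero_mem _
  | hadd x y hx hy => exact add_mem hx hy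
  | hsmul c x hx => exact Submodule.smul_mem _ _ hx
  | hidem a => exact Submodule.subset_span (Or.inl ⟨a, rfl⟩)
  | harrow a b α => exact Submodule.subset_span (Or.inr ⟨⟨a, b, α⟩, rfl⟩)

end AdmissiblePresentation

end

/-! ### Modules: vertex spaces, dimension vectors, radicals and simple summands. -/

noncomputable section

section Radical

variable {Λ : Type*} [Ring Λ] {X Y : Type*} [AddCommGroup X] [Module Λ X]
  [AddCommGroup Y] [Module Λ Y]

theorem map_mem_radModule (f : X →ₗ[Λ] Y) {x : X} (hx : x ∈ radModule Λ X) :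
    f x ∈ radModule Λ Y := by
  unfold radModule at hx
  induction hx using Submodule.smul_induction_on' with
  | smul j hj x _ => rw [map_smul]; exact Submodule.smul_mem_smul hj trivial
  | add x _ y _ hx hy => rw [map_add]; exact add_mem hx hy

theorem map_radModule_of_surjective (f : X →ₗ[Λ] Y) (hf : Function.Surjective f) :
    (radModule Λ X).map f = radModule Λ Y := by
  apply le_antisymm
  · rintro _ ⟨x, hx, rfl⟩
    exact map_mem_radModule f hx
  · refine Submodule.smul_le.2 fun j hj y _ => ?_
    obtain ⟨x, rfl⟩ := hf y
    exact ⟨j • x, Submodule.smul_mem_smul hj trivial, map_smul _ _ _⟩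

/-- An isomorphism of modules restricts to their radicals. -/
def radModuleEquiv (e : X ≃ₗ[Λ] Y) : radModule Λ X ≃ₗ[Λ] radModule Λ Y :=
  e.ofSubmodules _ _ (map_radModule_of_surjective e.toLinearMap e.surjective)

end Radical

namespace AdmissiblePresentation

open PathAlgebra

variable {K : Type u} [Field K] {V : Type v} [Quiver.{w} V] [Fintype V] [DecidableEq V]
  {Λ : Type*} [Ring Λ] [Algebra K Λ] (π : AdmissiblePresentation K V Λ)

section

variable (M : Type*) [AddCommGroup M] [Module K M] [Module Λ M] [IsScalarTower K Λ M]

/-- The subspace `e_a M` of a module `M`. -/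
def vertexSpace (a : V) : Submodule K M := LinearMap.range (Algebra.lsmul K K M (π.idem a))

theorem dimVec_eq (a : V) : π.dimVec M a = Module.finrank K (π.vertexSpace M a) := rfl

end

section Basic

variable {M : Type*} [AddCommGroup M] [Module K M] [Module Λ M] [IsScalarTower K Λ M]
variable {N : Type*} [AddCommGroup N] [Module K N] [Module Λ N] [IsScalarTower K Λ N]

theorem idem_smul_mem (a : V) (m : M) : π.idem a • m ∈ π.vertexSpace M a := ⟨m, rfl⟩

theorem mem_vertexSpace {a : V} {m : M} : m ∈ π.vertexSpace M a ↔ π.idem a • m = m := by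
  refine ⟨?_, fun h => ⟨m, h⟩⟩
  rintro ⟨x, rfl⟩
  change π.idem a • π.idem a • x = π.idem a • x
  rw [← mul_smul, idem_mul_idem_self]

theorem idem_smul_of_ne {a b : V} (h : b ≠ a) {m : M} (hm : m ∈ π.vertexSpace M a) :
    π.idem b • m = 0 := by
  rw [← π.mem_vertexSpace.1 hm, ← mul_smul, idem_mul_idem_of_ne _ h, zero_smul]

theorem arrow_smul_mem {a b : V} (α : a ⟶ b) (m : M) : π.arrow α • m ∈ π.vertexSpace M b := by
  rw [mem_vertexSpace, ← mul_smul, idem_mul_arrow]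

omit [Module K M] [IsScalarTower K Λ M] in
theorem arrow_smul_idem_smul {a b : V} (α : a ⟶ b) (m : M) :
    π.arrow α • π.idem a • m = π.arrow α • m := by
  rw [← mul_smul, arrow_mul_idem]

omit [Module K M] [IsScalarTower K Λ M] in
theorem sum_idem_smul (m : M) : ∑ a, π.idem a • m = m := by
  rw [← Finset.sum_smul, sum_idem, one_smul]

theorem map_mem_vertexSpace (f : M →ₗ[Λ] N) {a : V} {m : M} (hm : m ∈ π.vertexSpace M a) :
    f m ∈ π.vertexSpace N a := by
  rw [mem_vertexSpace, ← map_smul, π.mem_vertexSpace.1 hm]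

theorem coe_mem_vertexSpace {P : Submodule Λ M} {a : V} {m : P} :
    m ∈ π.vertexSpace P a ↔ (m : M) ∈ π.vertexSpace M a := by
  rw [mem_vertexSpace, mem_vertexSpace, Subtype.ext_iff]; rfl

/-- A module is the direct sum of its vertex spaces. -/
def vertexEquiv (M : Type*) [AddCommGroup M] [Module K M] [Module Λ M] [IsScalarTower K Λ M] :
    M ≃ₗ[K] ∀ a, π.vertexSpace M a where
  toFun m a := ⟨π.idem a • m, π.idem_smul_mem a m⟩
  map_add' x y := by ext a; simp
  map_smul' c x := by ext a; exact smul_comm _ _ _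
  invFun f := ∑ a, (f a : M)
  left_inv m := π.sum_idem_smul m
  right_inv f := by
    ext a
    change π.idem a • ∑ b, (f b : M) = f a
    rw [Finset.smul_sum, Finset.sum_eq_single a]
    · exact π.mem_vertexSpace.1 (f a).2
    · exact fun b _ h => π.idem_smul_of_ne h.symm (f b).2
    · simp

theorem vertexEquiv_apply (m : M) (a : V) : (π.vertexEquiv M m a : M) = π.idem a • m := rfl

theorem finrank_eq_sum_dimVec [Module.Finite K M] : Module.finrank K M = ∑ a, π.dimVec M a := by
  rw [(π.vertexEquiv M).finrank_eq, Module.finrank_pi_fintype]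
  rfl

theorem dimVec_le_of_injective (f : M →ₗ[Λ] N) (hf : Function.Injective f) (a : V)
    [Module.Finite K (π.vertexSpace N a)] : π.dimVec M a ≤ π.dimVec N a := by
  let g : π.vertexSpace M a →ₗ[K] π.vertexSpace N a :=
    (f.restrictScalars K).restrict fun m hm => π.map_mem_vertexSpace f hm
  have hg : Function.Injective g := fun x y h => Subtype.ext (hf (congrArg Subtype.val h))
  rw [dimVec_eq, dimVec_eq]
  exact LinearMap.finrank_le_finrank_of_injective hg

theorem dimVec_congr (f : M ≃ₗ[Λ] N) (a : V) : π.dimVec M a = π.dimVec N a := by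
  refine LinearEquiv.finrank_eq ((f.restrictScalars K).ofSubmodules _ _ ?_)
  ext y
  refine ⟨?_, fun hy => ?_⟩
  · rintro ⟨x, hx, rfl⟩
    exact π.map_mem_vertexSpace f.toLinearMap hx
  · exact ⟨f.symm y, π.map_mem_vertexSpace f.symm.toLinearMap hy, f.apply_symm_apply y⟩

theorem dimVec_eq_add_ker [Module.Finite K M] (f : M →ₗ[Λ] N) (hf : Function.Surjective f)
    (a : V) : π.dimVec M a = π.dimVec N a + π.dimVec (LinearMap.ker f) a := by
  set g : π.vertexSpace M a →ₗ[K] N := (f.restrictScalars K).domRestrict _ with hg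
  have h1 := g.finrank_range_add_finrank_ker
  have hr : LinearMap.range g = π.vertexSpace N a := by
    ext y
    refine ⟨?_, fun hy => ?_⟩
    · rintro ⟨x, rfl⟩
      exact π.map_mem_vertexSpace f x.2
    · obtain ⟨x, rfl⟩ := hf y
      exact ⟨⟨_, π.idem_smul_mem a x⟩, by
        change f (π.idem a • x) = f x
        rw [map_smul, π.mem_vertexSpace.1 hy]⟩
  have hk : Module.finrank K (LinearMap.ker g) = π.dimVec (LinearMap.ker f) a := by
    refine LinearEquiv.finrank_eq
      { toFun := fun x => ⟨⟨x.1.1, x.2⟩, π.coe_mem_vertexSpace.2 x.1.2⟩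
        map_add' := fun _ _ => rfl
        map_smul' := fun _ _ => rfl
        invFun := fun x => ⟨⟨x.1.1, π.coe_mem_vertexSpace.1 x.2⟩, x.1.2⟩
        left_inv := fun _ => rfl
        right_inv := fun _ => rfl }
  rw [← hk, dimVec_eq, dimVec_eq, ← h1, hr]

theorem dimVec_quotient_add [Module.Finite K M] (P : Submodule Λ M) (a : V) :
    π.dimVec (M ⧸ P) a + π.dimVec P a = π.dimVec M a := by
  rw [π.dimVec_eq_add_ker P.mkQ P.mkQ_surjective a]
  congr 1
  exact π.dimVec_congr (LinearEquiv.ofEq _ _ P.ker_mkQ.symm) a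

theorem dimVec_prod [Module.Finite K M] [Module.Finite K N] (a : V) :
    π.dimVec (M × N) a = π.dimVec M a + π.dimVec N a := by
  rw [π.dimVec_eq_add_ker (LinearMap.snd Λ M N) Prod.snd_surjective a, add_comm]
  congr 1
  refine (π.dimVec_congr (?_ : M ≃ₗ[Λ] _) a).symm
  exact (LinearEquiv.ofInjective (LinearMap.inl Λ M N) LinearMap.inl_injective).trans
    (LinearEquiv.ofEq _ _ (LinearMap.range_inl Λ M N))

end Basic

section Linear

variable {M : Type*} [AddCommGroup M] [Module K M] [Module Λ M] [IsScalarTower K Λ M]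
variable {N : Type*} [AddCommGroup N] [Module K N] [Module Λ N] [IsScalarTower K Λ N]
variable (hJ : Ring.jacobson Λ ^ 2 = ⊥)

/-- A `K`-linear map commuting with vertex idempotents and arrows is `Λ`-linear. -/
def linearMapOfGenerators (f : M →ₗ[K] N) (hidem : ∀ a m, f (π.idem a • m) = π.idem a • f m)
    (harrow : ∀ (a b : V) (α : a ⟶ b) m, f (π.arrow α • m) = π.arrow α • f m) : M →ₗ[Λ] N where
  toFun := f
  map_add' := map_add f
  map_smul' r m := by
    change f (r • m) = r • f m
    induction r using π.induction_generators hJ with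
    | hz => simp
    | hadd x y hx hy => rw [add_smul, map_add, hx, hy, add_smul]
    | hsmul c x hx => rw [smul_assoc, map_smul, hx, smul_assoc]
    | hidem a => exact hidem a m
    | harrow a b α => exact harrow a b α m

/-- A module is annihilated by all arrows, equivalently by the Jacobson radical. -/
def IsKilled (M : Type*) [AddCommGroup M] [Module Λ M] : Prop :=
  ∀ (a b : V) (α : a ⟶ b) (m : M), π.arrow α • m = 0

omit [Module K M] [IsScalarTower K Λ M] in
theorem isKilled_of_isSemisimpleModule [IsSemisimpleModule Λ M] : π.IsKilled M :=
  fun _ _ α m => Module.mem_annihilator.1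
    (IsSemisimpleModule.jacobson_le_annihilator Λ M (π.arrow_mem_jacobson α)) m

variable {π} in
include hJ in
-- When the arrows act by zero, only the decomposition into vertex spaces is left, so injections
-- chosen vertex by vertex assemble to a `Λ`-linear one.
theorem IsKilled.exists_linearMap (hM : π.IsKilled M) (hN : π.IsKilled N) [Module.Finite K M]
    [Module.Finite K N] (h : ∀ a, π.dimVec M a ≤ π.dimVec N a) :
    ∃ f : M →ₗ[Λ] N, Function.Injective f := by
  classical
  have hφ : ∀ a, ∃ φ : π.vertexSpace M a →ₗ[K] π.vertexSpace N a, Function.Injective φ := by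
    intro a
    exact finrank_le_iff_exists_linearMap.1 (h a)
  choose φ hφ using hφ
  let F : M →ₗ[K] N := (π.vertexEquiv N).symm.toLinearMap ∘ₗ LinearMap.piMap φ ∘ₗ
    (π.vertexEquiv M).toLinearMap
  have hF : ∀ m a, π.idem a • F m = φ a ⟨π.idem a • m, π.idem_smul_mem a m⟩ := by
    intro m a
    rw [← vertexEquiv_apply]
    simp [F]
    rfl
  refine ⟨π.linearMapOfGenerators hJ F ?_ ?_, ?_⟩
  · intro a m
    rw [← π.sum_idem_smul (F (π.idem a • m)), Finset.sum_eq_single a]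
    · rw [hF, hF]
      congr 2
      rw [Subtype.mk.injEq, ← mul_smul, idem_mul_idem_self]
    · intro b _ hb
      rw [hF]
      have : (⟨π.idem b • π.idem a • m, π.idem_smul_mem b _⟩ : π.vertexSpace M b) = 0 :=
        Subtype.ext (π.idem_smul_of_ne hb (π.idem_smul_mem a m))
      rw [this, map_zero]; rfl
    · simp
  · intro a b α m
    rw [hM, hN, map_zero]
  · intro x y hxy
    have hxy' : F x = F y := hxy
    rw [← π.sum_idem_smul x, ← π.sum_idem_smul y]
    refine Finset.sum_congr rfl fun a _ => ?_
    have h1 := hF x a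
    rw [hxy', hF] at h1
    exact congrArg Subtype.val (hφ a (Subtype.ext h1)).symm

variable {π} in
include hJ in
theorem IsKilled.nonempty_linearEquiv (hM : π.IsKilled M) (hN : π.IsKilled N) [Module.Finite K M]
    [Module.Finite K N] (h : ∀ a, π.dimVec M a = π.dimVec N a) : Nonempty (M ≃ₗ[Λ] N) := by
  obtain ⟨f, hf⟩ := hM.exists_linearMap hJ hN fun a => (h a).le
  refine ⟨LinearEquiv.ofBijective f ⟨hf, ?_⟩⟩
  have hdim : Module.finrank K M = Module.finrank K N := by
    rw [π.finrank_eq_sum_dimVec, π.finrank_eq_sum_dimVec]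
    exact Finset.sum_congr rfl fun a _ => h a
  exact (LinearMap.injective_iff_surjective_of_finrank_eq_finrank hdim
    (f := f.restrictScalars K)).1 hf

end Linear

section Radical

variable {M : Type*} [AddCommGroup M] [Module K M] [Module Λ M] [IsScalarTower K Λ M]
variable (hJ : Ring.jacobson Λ ^ 2 = ⊥)

omit [Module K M] [IsScalarTower K Λ M] in
theorem arrow_smul_mem_radModule {a b : V} (α : a ⟶ b) (m : M) :
    π.arrow α • m ∈ radModule Λ M :=
  Submodule.smul_mem_smul (π.arrow_mem_jacobson α) trivial

omit [Module K M] [IsScalarTower K Λ M] in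
include hJ in
theorem arrow_smul_of_mem_radModule {a b : V} (α : a ⟶ b) {m : M} (hm : m ∈ radModule Λ M) :
    π.arrow α • m = 0 := by
  unfold radModule at hm
  induction hm using Submodule.smul_induction_on' with
  | smul j hj x _ =>
    rw [← mul_smul, mul_eq_zero_of_mem_jacobson hJ (π.arrow_mem_jacobson α) hj, zero_smul]
  | add x _ y _ hx hy => rw [smul_add, hx, hy, add_zero]

include hJ in
theorem isKilled_radModule (M : Type*) [AddCommGroup M] [Module Λ M] :
    π.IsKilled (radModule Λ M) :=
  fun _ _ α m => Subtype.ext (π.arrow_smul_of_mem_radModule hJ α m.2)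

theorem isKilled_quotient_radModule (M : Type*) [AddCommGroup M] [Module Λ M] :
    π.IsKilled (M ⧸ radModule Λ M) := by
  intro a b α m
  obtain ⟨m, rfl⟩ := Submodule.mkQ_surjective _ m
  rw [← map_smul]
  exact (Submodule.Quotient.mk_eq_zero _).2 (π.arrow_smul_mem_radModule α m)

variable {π} in
include hJ in
theorem IsKilled.radModule_eq_bot {M : Type*} [AddCommGroup M] [Module K M] [Module Λ M]
    [IsScalarTower K Λ M] (h : π.IsKilled M) : radModule Λ M = ⊥ := by
  rw [eq_bot_iff]
  refine Submodule.smul_le.2 fun j hj m _ => ?_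
  have hj' := (π.mem_jacobson_iff hJ j).1 hj
  rw [Submodule.mem_bot]
  induction hj' using Submodule.span_induction with
  | zero => simp
  | add x y hx hy h h' =>
    rw [add_smul, h (π.arrowSpan_le hx), h' (π.arrowSpan_le hy), add_zero]
  | smul c x hx h => rw [smul_assoc, h (π.arrowSpan_le hx), smul_zero]
  | mem x hx =>
    obtain ⟨a, b, α, rfl⟩ := hx
    exact h a b α m

variable [∀ a b : V, Fintype (a ⟶ b)]

include hJ in
theorem exists_idem_smul_eq_sum {m : M} (hm : m ∈ radModule Λ M) (b : V) :
    ∃ w : (Σ a, a ⟶ b) → M, π.idem b • m = ∑ p, π.arrow p.2 • w p := by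
  classical
  unfold radModule at hm
  induction hm using Submodule.smul_induction_on' with
  | smul j hj x _ =>
    have hj' := (π.mem_jacobson_iff hJ j).1 hj
    induction hj' using Submodule.span_induction with
    | zero => exact ⟨0, by simp⟩
    | add y z hy hz h h' =>
      obtain ⟨w, hw⟩ := h (π.arrowSpan_le hy)
      obtain ⟨w', hw'⟩ := h' (π.arrowSpan_le hz)
      exact ⟨w + w', by simp [add_smul, hw, hw', Finset.sum_add_distrib]⟩
    | smul c y hy h =>
      obtain ⟨w, hw⟩ := h (π.arrowSpan_le hy)
      refine ⟨c • w, ?_⟩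
      rw [smul_assoc, smul_comm, hw, Finset.smul_sum]
      exact Finset.sum_congr rfl fun p _ => smul_comm _ _ _
    | mem y hy =>
      obtain ⟨a, c, α, rfl⟩ := hy
      by_cases h : b = c
      · subst h
        refine ⟨Pi.single ⟨a, α⟩ x, ?_⟩
        rw [Finset.sum_eq_single ⟨a, α⟩]
        · rw [Pi.single_eq_same, ← mul_smul, idem_mul_arrow]
        · intro p _ hp
          rw [Pi.single_eq_of_ne hp, smul_zero]
        · simp
      · exact ⟨0, by rw [← mul_smul, idem_mul_arrow_of_ne _ h]; simp⟩
  | add x _ y _ hx hy =>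
    obtain ⟨w, hw⟩ := hx
    obtain ⟨w', hw'⟩ := hy
    exact ⟨w + w', by simp [hw, hw', Finset.sum_add_distrib]⟩

include hJ in
/-- The radical of a module is bounded by its top and the number of arrows. -/
theorem dimVec_radModule_le (M : Type*) [AddCommGroup M] [Module K M] [Module Λ M]
    [IsScalarTower K Λ M] [Module.Finite K (M ⧸ radModule Λ M)] (b : V) :
    Module.Finite K (π.vertexSpace (radModule Λ M) b) ∧
    π.dimVec (radModule Λ M) b ≤
      ∑ a, Fintype.card (a ⟶ b) * π.dimVec (M ⧸ radModule Λ M) a := by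
  classical
  -- The section is only `K`-linear. Arrows applied to its values still produce all of `J M`,
  -- because they kill the error, which lies in `J M`.
  obtain ⟨σ, hσ⟩ := LinearMap.exists_rightInverse_of_surjective
    ((radModule Λ M).mkQ.restrictScalars K)
    (LinearMap.range_eq_top.2 (radModule Λ M).mkQ_surjective)
  have hσ' : ∀ m : M, m - σ ((radModule Λ M).mkQ m) ∈ radModule Λ M := by
    intro m
    refine (Submodule.Quotient.mk_eq_zero _).1 ?_
    rw [Submodule.Quotient.mk_sub, sub_eq_zero]
    exact (LinearMap.congr_fun hσ ((radModule Λ M).mkQ m)).symm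
  let Ψ : (∀ p : (Σ a, a ⟶ b), π.vertexSpace (M ⧸ radModule Λ M) p.1) →ₗ[K] M :=
    ∑ p, Algebra.lsmul K K M (π.arrow p.2) ∘ₗ σ ∘ₗ Submodule.subtype _ ∘ₗ LinearMap.proj p
  have hΨ : ∀ f, Ψ f = ∑ p, π.arrow p.2 • σ (f p) := by
    intro f
    simp [Ψ]
  let ι : π.vertexSpace (radModule Λ M) b →ₗ[K] M :=
    (radModule Λ M).subtype.restrictScalars K ∘ₗ Submodule.subtype _
  have hι : Function.Injective ι := fun x y h => Subtype.ext (Subtype.ext h)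
  have hle : LinearMap.range ι ≤ LinearMap.range Ψ := by
    rintro _ ⟨m, rfl⟩
    obtain ⟨w, hw⟩ := π.exists_idem_smul_eq_sum hJ m.1.2 b
    have hm := π.mem_vertexSpace.1 (π.coe_mem_vertexSpace.1 m.2)
    rw [hm] at hw
    refine ⟨fun p => ⟨π.idem p.1 • (radModule Λ M).mkQ (w p), π.idem_smul_mem _ _⟩, ?_⟩
    rw [hΨ]
    change _ = (m.1.1 : M)
    rw [hw]
    refine Finset.sum_congr rfl fun p _ => ?_
    have h1 := π.arrow_smul_of_mem_radModule hJ p.2 (hσ' (π.idem p.1 • w p))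
    rw [smul_sub, sub_eq_zero, arrow_smul_idem_smul, map_smul] at h1
    exact h1.symm
  have hfin : Module.Finite K (LinearMap.range ι) :=
    Submodule.finiteDimensional_of_le hle
  have e := LinearEquiv.ofInjective ι hι
  refine ⟨Module.Finite.equiv e.symm, ?_⟩
  calc π.dimVec (radModule Λ M) b = Module.finrank K (LinearMap.range ι) := e.finrank_eq
    _ ≤ Module.finrank K (LinearMap.range Ψ) := Submodule.finrank_mono hle
    _ ≤ _ := LinearMap.finrank_range_le Ψ
    _ = ∑ p : (Σ a, a ⟶ b), π.dimVec (M ⧸ radModule Λ M) p.1 := by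
      rw [Module.finrank_pi_fintype]; rfl
    _ = _ := by
      rw [Fintype.sum_sigma]
      simp

end Radical

section Simple

variable {M : Type*} [AddCommGroup M] [Module K M] [Module Λ M] [IsScalarTower K Λ M]
variable (hJ : Ring.jacobson Λ ^ 2 = ⊥)

include hJ in
-- Idempotents multiply `m` by zero or one and arrows kill it, so `Λ m` is at most a line.
theorem exists_smul_eq_smul {a : V} {m : M} (hm : m ∈ π.vertexSpace M a)
    (hk : ∀ (b : V) (α : a ⟶ b), π.arrow α • m = 0) (r : Λ) : ∃ c : K, r • m = c • m := by
  induction r using π.induction_generators hJ with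
  | hz => exact ⟨0, by simp⟩
  | hadd x y hx hy =>
    obtain ⟨c, hc⟩ := hx
    obtain ⟨c', hc'⟩ := hy
    exact ⟨c + c', by rw [add_smul, add_smul, hc, hc']⟩
  | hsmul k x hx =>
    obtain ⟨c, hc⟩ := hx
    exact ⟨k * c, by rw [smul_assoc, hc, mul_smul]⟩
  | hidem b =>
    by_cases h : b = a
    · exact ⟨1, by rw [h, π.mem_vertexSpace.1 hm, one_smul]⟩
    · exact ⟨0, by rw [π.idem_smul_of_ne h hm, zero_smul]⟩
  | harrow b c α =>
    by_cases h : b = a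
    · subst h
      exact ⟨0, by rw [hk, zero_smul]⟩
    · refine ⟨0, ?_⟩
      rw [← arrow_smul_idem_smul, π.idem_smul_of_ne h hm, smul_zero, zero_smul]

include hJ in
theorem isSimpleModule_span_singleton {a : V} {m : M} (hm : m ∈ π.vertexSpace M a) (h0 : m ≠ 0)
    (hk : ∀ (b : V) (α : a ⟶ b), π.arrow α • m = 0) :
    IsSimpleModule Λ (Submodule.span Λ {m}) := by
  rw [isSimpleModule_iff_toSpanSingleton_surjective]
  refine ⟨⟨⟨⟨m, Submodule.mem_span_singleton_self m⟩, 0, fun h => h0 (congrArg Subtype.val h)⟩⟩, ?_⟩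
  rintro ⟨x, hx⟩ hx0 ⟨y, hy⟩
  obtain ⟨r, rfl⟩ := Submodule.mem_span_singleton.1 hx
  obtain ⟨s, rfl⟩ := Submodule.mem_span_singleton.1 hy
  obtain ⟨c, hc⟩ := π.exists_smul_eq_smul hJ hm hk r
  have hc0 : c ≠ 0 := by
    rintro rfl
    exact hx0 (Subtype.ext (by simpa using hc))
  refine ⟨s * algebraMap K Λ c⁻¹, Subtype.ext ?_⟩
  change (s * algebraMap K Λ c⁻¹) • r • m = s • m
  rw [hc, mul_smul, algebraMap_smul, smul_smul, inv_mul_cancel₀ hc0, one_smul]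

variable {π} in
include hJ in
theorem IsKilled.isSemisimpleModule (h : π.IsKilled M) : IsSemisimpleModule Λ M := by
  rw [← sSup_simples_eq_top_iff_isSemisimpleModule, eq_top_iff]
  rintro m -
  rw [← π.sum_idem_smul m]
  refine Submodule.sum_mem _ fun a _ => ?_
  by_cases h0 : π.idem a • m = 0
  · rw [h0]; exact zero_mem _
  · have := π.isSimpleModule_span_singleton hJ (π.idem_smul_mem a m) h0 fun b α => h a b α _
    exact (le_sSup (show _ ∈ {N : Submodule Λ M | IsSimpleModule Λ N} from this))
      (Submodule.mem_span_singleton_self _)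

include hJ in
-- The radical annihilates a simple module, so a nonzero vector at a vertex already spans it over
-- `K`.
theorem dimVec_of_isSimpleModule [IsSimpleModule Λ M] : ∃ (v : V) (m : M),
    m ∈ π.vertexSpace M v ∧ m ≠ 0 ∧ π.dimVec M = Pi.single v 1 := by
  classical
  have hk : π.IsKilled M := π.isKilled_of_isSemisimpleModule
  have := IsSimpleModule.nontrivial Λ M
  obtain ⟨x, hx⟩ := exists_ne (0 : M)
  obtain ⟨v, hv⟩ : ∃ v, π.idem v • x ≠ 0 := by
    by_contra! h
    apply hx
    rw [← π.sum_idem_smul x]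
    exact Finset.sum_eq_zero fun a _ => h a
  set m := π.idem v • x with hmdef
  have hm : m ∈ π.vertexSpace M v := π.idem_smul_mem v x
  have hall : ∀ y : M, ∃ c : K, y = c • m := by
    intro y
    obtain ⟨r, rfl⟩ := IsSimpleModule.toSpanSingleton_surjective Λ hv y
    exact π.exists_smul_eq_smul hJ hm (fun b α => hk v b α m) r
  refine ⟨v, m, hm, hv, ?_⟩
  ext a
  rw [dimVec_eq]
  by_cases h : a = v
  · subst h
    rw [Pi.single_eq_same]
    refine finrank_eq_one (⟨m, hm⟩ : π.vertexSpace M a) (fun h => hv (congrArg Subtype.val h)) ?_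
    rintro ⟨y, hy⟩
    obtain ⟨c, rfl⟩ := hall y
    exact ⟨c, rfl⟩
  · rw [Pi.single_eq_of_ne h]
    have : π.vertexSpace M a = ⊥ := by
      rw [eq_bot_iff]
      intro y hy
      obtain ⟨c, rfl⟩ := hall y
      rw [Submodule.mem_bot, ← π.mem_vertexSpace.1 hy, smul_comm, π.idem_smul_of_ne h hm, smul_zero]
    rw [this, finrank_bot]

end Simple

section Complement

variable {M : Type*} [AddCommGroup M] [Module K M] [Module Λ M] [IsScalarTower K Λ M]
variable (hJ : Ring.jacobson Λ ^ 2 = ⊥)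

theorem dimVec_add_of_isCompl [Module.Finite K M] {P S : Submodule Λ M} (h : IsCompl P S) (a : V) :
    π.dimVec P a + π.dimVec S a = π.dimVec M a := by
  have : Module.Finite K P := Module.Finite.of_injective (P.subtype.restrictScalars K)
    Subtype.val_injective
  have : Module.Finite K S := Module.Finite.of_injective (S.subtype.restrictScalars K)
    Subtype.val_injective
  rw [← dimVec_prod, π.dimVec_congr (Submodule.prodEquivOfIsCompl P S h)]

variable {π} in
include hJ in
-- The projection to `S` sends `J M` into `J S = 0`, so the complement `P` carries the whole
-- radical.
theorem IsKilled.map_radModule {P S : Submodule Λ M} (h : IsCompl P S) (hS : π.IsKilled S) :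
    (radModule Λ P).map P.subtype = radModule Λ M := by
  apply le_antisymm
  · rintro _ ⟨x, hx, rfl⟩
    exact map_mem_radModule P.subtype hx
  · intro m hm
    refine ⟨P.projectionOnto S h m, map_mem_radModule _ hm, ?_⟩
    have h1 : S.projectionOnto P h.symm m = 0 := by
      have := map_mem_radModule (S.projectionOnto P h.symm) hm
      rwa [hS.radModule_eq_bot hJ, Submodule.mem_bot] at this
    have h2 := Submodule.projection_add_projection_eq_self h m
    rw [Submodule.projection_apply, Submodule.projection_apply, h1] at h2
    simpa using h2

variable {π} in
include hJ in
theorem IsKilled.dimVec_radModule {P S : Submodule Λ M} (h : IsCompl P S) (hS : π.IsKilled S)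
    (a : V) : π.dimVec (radModule Λ P) a = π.dimVec (radModule Λ M) a :=
  π.dimVec_congr ((Submodule.equivMapOfInjective P.subtype Subtype.val_injective _).trans
    (LinearEquiv.ofEq _ _ (hS.map_radModule hJ h))) a

end Complement

end AdmissiblePresentation

end

/-! ### Projective covers and the embedding condition in terms of dimension vectors. -/

noncomputable section

section Radical

variable {Λ : Type*} [Ring Λ] {M : Type*} [AddCommGroup M] [Module Λ M]

theorem smul_eq_zero_of_mem_radModule (hJ : Ring.jacobson Λ ^ 2 = ⊥) {j : Λ}
    (hj : j ∈ Ring.jacobson Λ) {m : M} (hm : m ∈ radModule Λ M) : j • m = 0 := by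
  unfold radModule at hm
  induction hm using Submodule.smul_induction_on' with
  | smul i hi x _ =>
    rw [← mul_smul, AdmissiblePresentation.mul_eq_zero_of_mem_jacobson hJ hj hi, zero_smul]
  | add x _ y _ hx hy => rw [smul_add, hx, hy, add_zero]

/-- Nakayama's lemma for rings whose radical has square zero. -/
theorem eq_top_of_sup_radModule_eq_top (hJ : Ring.jacobson Λ ^ 2 = ⊥) {N : Submodule Λ M}
    (h : N ⊔ radModule Λ M = ⊤) : N = ⊤ := by
  rw [← h, left_eq_sup]
  refine Submodule.smul_le.2 fun j hj m _ => ?_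
  obtain ⟨n, hn, r, hr, rfl⟩ := Submodule.mem_sup.1 (h.symm ▸ Submodule.mem_top : m ∈ N ⊔ _)
  rw [smul_add, smul_eq_zero_of_mem_radModule hJ hj hr, add_zero]
  exact N.smul_mem j hn

end Radical

namespace AdmissiblePresentation

open PathAlgebra

variable {K : Type u} [Field K] {V : Type v} [Quiver.{w} V] [Fintype V] [DecidableEq V]
  {Λ : Type u₁} [Ring Λ] [Algebra K Λ] (π : AdmissiblePresentation K V Λ)
variable (hJ : Ring.jacobson Λ ^ 2 = ⊥)

section Cover

variable {P : Type*} [AddCommGroup P] [Module K P] [Module Λ P] [IsScalarTower K Λ P]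
variable {M : Type*} [AddCommGroup M] [Module Λ M]

include π hJ in
-- Take a complement to the image of the kernel in the semisimple module `P / J P`. Its preimage and
-- the kernel together span `P`, so by superfluity the complement is everything and the image is
-- zero. No finiteness of `P` is needed.
theorem ker_le_radModule {f : P →ₗ[Λ] M} (hf : IsProjectiveCover f) :
    LinearMap.ker f ≤ radModule Λ P := by
  have := (π.isKilled_quotient_radModule P).isSemisimpleModule hJ
  obtain ⟨C, hC⟩ := exists_isCompl ((LinearMap.ker f).map (radModule Λ P).mkQ)
  have hN : C.comap (radModule Λ P).mkQ ⊔ LinearMap.ker f = ⊤ := by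
    rw [eq_top_iff]
    rintro p -
    obtain ⟨_, ⟨k, hk, rfl⟩, c, hc, hkc⟩ := Submodule.mem_sup.1
      (hC.sup_eq_top.symm ▸ Submodule.mem_top : (radModule Λ P).mkQ p ∈ _ ⊔ C)
    refine Submodule.mem_sup.2 ⟨p - k, ?_, k, hk, sub_add_cancel _ _⟩
    rw [Submodule.mem_comap, map_sub, ← hkc, add_sub_cancel_left]
    exact hc
  have hC' : C = ⊤ := by
    rw [eq_top_iff]
    rintro x -
    obtain ⟨p, rfl⟩ := (radModule Λ P).mkQ_surjective x
    have : p ∈ C.comap (radModule Λ P).mkQ := hf.superfluous _ hN ▸ Submodule.mem_top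
    exact this
  have h0 := hC.inf_eq_bot
  rw [hC', inf_top_eq, ← le_bot_iff, Submodule.map_le_iff_le_comap, Submodule.comap_bot,
    Submodule.ker_mkQ] at h0
  exact h0

include π hJ in
/-- A projective cover induces an isomorphism on tops. -/
theorem nonempty_top_equiv {f : P →ₗ[Λ] M} (hf : IsProjectiveCover f) :
    Nonempty ((P ⧸ radModule Λ P) ≃ₗ[Λ] (M ⧸ radModule Λ M)) := by
  set g := (radModule Λ M).mkQ ∘ₗ f with hg
  have hgs : Function.Surjective g := (radModule Λ M).mkQ_surjective.comp hf.surjective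
  have hk : LinearMap.ker g = radModule Λ P := by
    rw [hg, LinearMap.ker_comp, Submodule.ker_mkQ, ← map_radModule_of_surjective f hf.surjective,
      Submodule.comap_map_eq, sup_eq_left]
    exact π.ker_le_radModule hJ hf
  exact ⟨(Submodule.quotEquivOfEq _ _ hk.symm).trans (g.quotKerEquivOfSurjective hgs)⟩

end Cover

section Embedding

variable {M : Type*} [AddCommGroup M] [Module K M] [Module Λ M] [IsScalarTower K Λ M]

omit [Fintype V] in
theorem finite_submodule [Module.Finite K M] (P : Submodule Λ M) : Module.Finite K P :=
  Module.Finite.of_injective (P.subtype.restrictScalars K) Subtype.val_injective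

omit [Fintype V] in
theorem finite_quotient [Module.Finite K M] (P : Submodule Λ M) : Module.Finite K (M ⧸ P) :=
  Module.Finite.of_surjective (P.mkQ.restrictScalars K) P.mkQ_surjective

theorem finite_vertexSpace [Module.Finite K M] (a : V) : Module.Finite K (π.vertexSpace M a) :=
  FiniteDimensional.finiteDimensional_submodule _

include hJ in
theorem dimVec_top_of_isCompl [Module.Finite K M] {N S : Submodule Λ M} (h : IsCompl N S)
    (hS : π.IsKilled S) (a : V) :
    π.dimVec (N ⧸ radModule Λ N) a + π.dimVec S a = π.dimVec (M ⧸ radModule Λ M) a := by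
  have := finite_submodule (K := K) N
  have h1 := π.dimVec_add_of_isCompl h a
  have h2 := π.dimVec_quotient_add (radModule Λ N) a
  have h3 := π.dimVec_quotient_add (radModule Λ M) a
  have h4 := hS.dimVec_radModule hJ h a
  omega

variable [∀ a b : V, Fintype (a ⟶ b)]

include hJ in
-- `P` has the same top as `N`, namely that of `M` with `S` removed, and the top bounds the radical
-- of `P`; comparing dimensions at each vertex gives the inequality. The vector `m` is a generator
-- of `S`.
theorem exists_of_embedsInto [Module.Finite K M] {N S : Submodule Λ M} (h : IsCompl N S)
    [IsSimpleModule Λ S] {P : Type*} [AddCommGroup P] [Module Λ P] {f : P →ₗ[Λ] N}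
    (hf : IsProjectiveCover f) (he : EmbedsInto Λ (radModule Λ M × S) (radModule Λ P)) :
    ∃ (v : V) (m : M), m ∈ π.vertexSpace M v ∧ (∀ (a b : V) (α : a ⟶ b), π.arrow α • m = 0) ∧
      m ∉ radModule Λ M ∧
      ∀ b, π.dimVec (radModule Λ M) b + (Pi.single v 1 : V → ℕ) b ≤ ∑ a, Fintype.card (a ⟶ b) *
        (π.dimVec (M ⧸ radModule Λ M) a - (Pi.single v 1 : V → ℕ) a) := by
  -- `P` carries only a `Λ`-action, so its `K`-structure is induced from `Λ`.
  let _ : Module K P := Module.compHom P (algebraMap K Λ)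
  have : IsScalarTower K Λ P :=
    ⟨fun c r p => by rw [Algebra.smul_def, mul_smul]; rfl⟩
  have hS : π.IsKilled S := π.isKilled_of_isSemisimpleModule
  obtain ⟨v, m, hm, hm0, hd⟩ := π.dimVec_of_isSimpleModule hJ (M := S)
  have hfN := finite_submodule (K := K) N
  have hfS := finite_submodule (K := K) S
  have hfR := finite_submodule (K := K) (radModule Λ M)
  have hfQ := finite_quotient (K := K) (radModule Λ N)
  obtain ⟨e⟩ := π.nonempty_top_equiv hJ hf
  have hfP : Module.Finite K (P ⧸ radModule Λ P) :=
    Module.Finite.equiv (e.restrictScalars K).symm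
  have htop := π.dimVec_top_of_isCompl hJ h hS
  refine ⟨v, m, π.coe_mem_vertexSpace.1 hm, fun a b α => congrArg Subtype.val (hS a b α m),
    ?_, fun b => ?_⟩
  -- `J M` is the radical of `N`, so a vector of `S` in `J M` would lie in both summands.
  · rw [← hS.map_radModule hJ h]
    rintro ⟨x, _, hx⟩
    apply hm0
    have h1 : (m : M) ∈ N ⊓ S := ⟨hx ▸ x.2, m.2⟩
    rw [h.inf_eq_bot, Submodule.mem_bot] at h1
    exact Subtype.ext h1
  · obtain ⟨g, hg⟩ := he
    obtain ⟨hfin, hle⟩ := π.dimVec_radModule_le hJ P b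
    have h1 := π.dimVec_le_of_injective g hg b
    rw [dimVec_prod, hd] at h1
    refine (h1.trans hle).trans_eq (Finset.sum_congr rfl fun a _ => ?_)
    rw [π.dimVec_congr e a, ← htop a, hd, Nat.add_sub_cancel]

end Embedding

section Construction

variable {ι : Type*} [Fintype ι] [DecidableEq ι] (c : ι → V)

/-- The projective module `⨁_k Λ e_{c(k)}`, realized inside the free module on `ι`. -/
def projModule : Submodule Λ (ι → Λ) where
  carrier := {f | ∀ k, f k * π.idem (c k) = f k}
  zero_mem' k := zero_mul _
  add_mem' {f g} hf hg k := by rw [Pi.add_apply, add_mul, hf, hg]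
  smul_mem' r f hf k := by rw [Pi.smul_apply, smul_eq_mul, mul_assoc, hf]

/-- The generators of `projModule`. -/
def projGen (k : ι) : π.projModule c :=
  ⟨Pi.single k (π.idem (c k)), fun l => by
    by_cases h : l = k
    · subst h; rw [Pi.single_eq_same, idem_mul_idem_self]
    · rw [Pi.single_eq_of_ne h, zero_mul]⟩

theorem sum_smul_projGen (f : π.projModule c) : ∑ k, f.1 k • π.projGen c k = f := by
  refine Subtype.ext (funext fun l => ?_)
  have h : ((∑ k, f.1 k • π.projGen c k : π.projModule c) : ι → Λ) l =
      ∑ k, f.1 k * (Pi.single k (π.idem (c k)) : ι → Λ) l := by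
    rw [AddSubmonoidClass.coe_finsetSum, Finset.sum_apply]
    rfl
  rw [h, Finset.sum_eq_single l]
  · rw [Pi.single_eq_same]; exact f.2 l
  · intro b _ hb
    rw [Pi.single_eq_of_ne hb.symm, mul_zero]
  · simp

omit [DecidableEq ι] in
theorem projective_projModule : Module.Projective Λ (π.projModule c) := by
  let s : (ι → Λ) →ₗ[Λ] π.projModule c :=
    { toFun := fun f => ⟨fun k => f k * π.idem (c k), fun k => by
        rw [mul_assoc, idem_mul_idem_self]⟩
      map_add' := fun f g => Subtype.ext (funext fun k => add_mul _ _ _)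
      map_smul' := fun r f => Subtype.ext (funext fun k => mul_assoc _ _ _) }
  exact Module.Projective.of_split (π.projModule c).subtype s
    (LinearMap.ext fun f => Subtype.ext (funext f.2))

theorem mem_radModule_projModule {f : π.projModule c} (hf : ∀ k, f.1 k ∈ Ring.jacobson Λ) :
    f ∈ radModule Λ (π.projModule c) := by
  rw [← π.sum_smul_projGen c f]
  exact Submodule.sum_mem _ fun k _ => Submodule.smul_mem_smul (hf k) trivial

variable {M : Type*} [AddCommGroup M] [Module Λ M]

/-- The map from `projModule` given by a family of elements. -/
def projLift (m : ι → M) : π.projModule c →ₗ[Λ] M :=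
  (∑ k, LinearMap.toSpanSingleton Λ M (m k) ∘ₗ LinearMap.proj k) ∘ₗ (π.projModule c).subtype

omit [DecidableEq ι] in
theorem projLift_apply (m : ι → M) (f : π.projModule c) :
    π.projLift c m f = ∑ k, f.1 k • m k := by
  simp [projLift]

variable [Module K M] [IsScalarTower K Λ M]

theorem projLift_projGen (m : ι → M) (hm : ∀ k, m k ∈ π.vertexSpace M (c k)) (k : ι) :
    π.projLift c m (π.projGen c k) = m k := by
  rw [projLift_apply, Finset.sum_eq_single k]
  · change (Pi.single k (π.idem (c k)) : ι → Λ) k • m k = m k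
    rw [Pi.single_eq_same]
    exact π.mem_vertexSpace.1 (hm k)
  · intro b _ hb
    change (Pi.single k (π.idem (c k)) : ι → Λ) b • m b = 0
    rw [Pi.single_eq_of_ne hb, zero_smul]
  · simp

include hJ in
-- Modulo `J`, an element of the kernel has scalar coefficients on the generators, and these vanish
-- because the family lifts a basis of the top. So the kernel lies in the radical; surjectivity and
-- superfluity follow from Nakayama's lemma.
theorem isProjectiveCover_projLift (m : ι → M) (hm : ∀ k, m k ∈ π.vertexSpace M (c k))
    (B : Module.Basis ι K (M ⧸ radModule Λ M)) (hB : ∀ k, B k = (radModule Λ M).mkQ (m k)) :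
    IsProjectiveCover (π.projLift c m) := by
  have hker : LinearMap.ker (π.projLift c m) ≤ radModule Λ (π.projModule c) := by
    intro f hf
    have hc : ∀ k, ∃ x : K, f.1 k - x • π.idem (c k) ∈ Ring.jacobson Λ := by
      intro k
      obtain ⟨x, y, hy, hxy⟩ := π.exists_eq_sum_idem_add hJ (f.1 k)
      refine ⟨x (c k), ?_⟩
      have h1 := f.2 k
      rw [hxy, add_mul, Finset.sum_mul, Finset.sum_eq_single (c k), smul_mul_assoc,
        idem_mul_idem_self, ← hxy] at h1
      · rw [← h1, add_sub_cancel_left]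
        exact Ideal.mul_mem_right _ _ (π.arrowSpan_le hy)
      · intro b _ hb
        rw [smul_mul_assoc, idem_mul_idem_of_ne _ hb, smul_zero]
      · simp
    choose x hx using hc
    have hsum : ∑ k, x k • B k = 0 := by
      rw [LinearMap.mem_ker, projLift_apply] at hf
      have : (radModule Λ M).mkQ (∑ k, f.1 k • m k) = ∑ k, x k • B k := by
        rw [map_sum]
        refine Finset.sum_congr rfl fun k _ => ?_
        rw [hB, ← sub_eq_zero, ← LinearMap.map_smul_of_tower, ← map_sub]
        refine (Submodule.Quotient.mk_eq_zero _).2 ?_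
        have h2 : x k • m k = (x k • π.idem (c k)) • m k := by
          rw [smul_assoc, π.mem_vertexSpace.1 (hm k)]
        rw [h2, ← sub_smul]
        exact Submodule.smul_mem_smul (hx k) trivial
      rw [← this, hf, map_zero]
    have hx0 := Fintype.linearIndependent_iff.1 B.linearIndependent x hsum
    refine π.mem_radModule_projModule c fun k => ?_
    simpa [hx0 k] using hx k
  refine ⟨π.projective_projModule c, ?_, fun N hN => ?_⟩
  · rw [← LinearMap.range_eq_top]
    refine eq_top_of_sup_radModule_eq_top hJ ?_
    rw [← Submodule.ker_mkQ (radModule Λ M), ← Submodule.comap_map_eq, eq_top_iff]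
    rintro y -
    rw [Submodule.mem_comap, ← B.sum_repr ((radModule Λ M).mkQ y)]
    refine Submodule.sum_mem _ fun k _ => Submodule.smul_of_tower_mem _ _ ?_
    exact ⟨m k, ⟨_, π.projLift_projGen c m hm k⟩, (hB k).symm⟩
  · exact eq_top_of_sup_radModule_eq_top hJ (top_le_iff.1 (hN ▸ sup_le_sup_left hker N))

variable [∀ a b : V, Fintype (a ⟶ b)]

include hJ in
-- The products of arrows into `b` with generators at their sources are independent, because the
-- arrows are independent in `Λ`. This is the bound opposite to `dimVec_radModule_le`.
theorem le_dimVec_radModule_projModule (b : V) :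
    ∑ k, Fintype.card (c k ⟶ b) ≤ π.dimVec (radModule Λ (π.projModule c)) b := by
  have hΛ := π.module_finite hJ
  have h1 := finite_submodule (K := K) (π.projModule c)
  have h2 := finite_submodule (K := K) (radModule Λ (π.projModule c))
  have hmem : ∀ s : (Σ k, c k ⟶ b), π.arrow s.2 • π.projGen c s.1 ∈
      radModule Λ (π.projModule c) := fun s => π.arrow_smul_mem_radModule _ _
  let F : (Σ k, c k ⟶ b) → π.vertexSpace (radModule Λ (π.projModule c)) b := fun s =>
    ⟨⟨_, hmem s⟩, π.coe_mem_vertexSpace.2 (π.arrow_smul_mem s.2 _)⟩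
  let ψ : π.vertexSpace (radModule Λ (π.projModule c)) b →ₗ[K] (ι → Λ) :=
    (π.projModule c).subtype.restrictScalars K ∘ₗ
      (radModule Λ (π.projModule c)).subtype.restrictScalars K ∘ₗ Submodule.subtype _
  have hψ : ∀ s, ψ (F s) = Pi.single s.1 (π.arrow s.2) := by
    intro s
    change π.arrow s.2 • (Pi.single s.1 (π.idem (c s.1)) : ι → Λ) = _
    rw [← Pi.single_smul, smul_eq_mul, arrow_mul_idem]
  have hF : LinearIndependent K F := by
    refine LinearIndependent.of_comp ψ ?_
    have hcomp : ψ ∘ F = fun s : (Σ k, c k ⟶ b) =>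
        (Pi.single s.1 (π.arrow s.2) : ι → Λ) := funext hψ
    rw [hcomp]
    refine Pi.linearIndependent_single (fun k (α : c k ⟶ b) => π.arrow α) fun k => ?_
    refine π.linearIndependent_arrow.comp
      (fun α : c k ⟶ b => (⟨c k, b, α⟩ : Σ a b : V, a ⟶ b)) ?_
    intro α β h
    simpa using h
  have h3 := π.finite_vertexSpace (M := radModule Λ (π.projModule c)) b
  have := hF.fintype_card_le_finrank
  rwa [Fintype.card_sigma] at this

end Construction

section Existence

variable {M : Type*} [AddCommGroup M] [Module K M] [Module Λ M] [IsScalarTower K Λ M]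

/-- A basis adapted to the vertices. The last clause says that the vertex `a` occurs `π.dimVec M a`
times, in the form used for counting arrows. -/
theorem exists_vertexBasis (M : Type*) [AddCommGroup M] [Module K M] [Module Λ M]
    [IsScalarTower K Λ M] [Module.Finite K M] :
    ∃ (n : ℕ) (c : Fin n → V) (B : Module.Basis (Fin n) K M),
      (∀ k, B k ∈ π.vertexSpace M (c k)) ∧
      ∀ F : V → ℕ, ∑ k, F (c k) = ∑ a, F a * π.dimVec M a := by
  let b := fun a => Module.finBasis K (π.vertexSpace M a)
  let B := (Pi.basis b).map (π.vertexEquiv M).symm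
  let e := Fintype.equivFin (Σ a, Fin (Module.finrank K (π.vertexSpace M a)))
  refine ⟨_, fun k => (e.symm k).1, B.reindex e, fun k => ?_, fun F => ?_⟩
  · rw [Module.Basis.reindex_apply]
    change _ ∈ π.vertexSpace M (e.symm k).1
    generalize e.symm k = s
    have : B s = b s.1 s.2 := by
      simp only [B, Module.Basis.map_apply, Pi.basis_apply]
      change ∑ a, ((Pi.single s.1 (b s.1 s.2) : ∀ a, π.vertexSpace M a) a : M) = _
      rw [Finset.sum_eq_single s.1]
      · rw [Pi.single_eq_same]
      · intro a _ ha
        rw [Pi.single_eq_of_ne ha]; rfl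
      · simp
    rw [this]
    exact (b s.1 s.2).2
  · rw [Equiv.sum_comp e.symm (fun s => F s.1), Fintype.sum_sigma]
    refine Finset.sum_congr rfl fun a _ => ?_
    change ∑ _ : Fin (Module.finrank K (π.vertexSpace M a)), F a = _
    rw [Finset.sum_const, Finset.card_univ, Fintype.card_fin, smul_eq_mul, mul_comm, dimVec_eq]

variable [∀ a b : V, Fintype (a ⟶ b)]

include hJ in
theorem exists_projectiveCover (M : Type*) [AddCommGroup M] [Module K M] [Module Λ M]
    [IsScalarTower K Λ M] [Module.Finite K M] :
    ∃ (P : Type u₁) (_ : AddCommGroup P) (_ : Module K P) (_ : Module Λ P)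
      (_ : IsScalarTower K Λ P) (f : P →ₗ[Λ] M), Module.Finite K P ∧ IsProjectiveCover f ∧
      ∀ b, ∑ a, Fintype.card (a ⟶ b) * π.dimVec (M ⧸ radModule Λ M) a ≤
        π.dimVec (radModule Λ P) b := by
  have := finite_quotient (K := K) (radModule Λ M)
  have hΛ := π.module_finite hJ
  obtain ⟨n, c, B, hB, hc⟩ := π.exists_vertexBasis (M ⧸ radModule Λ M)
  have hm : ∀ k, ∃ m ∈ π.vertexSpace M (c k), B k = (radModule Λ M).mkQ m := by
    intro k
    obtain ⟨x, hx⟩ := (radModule Λ M).mkQ_surjective (B k)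
    exact ⟨_, π.idem_smul_mem (c k) x, by rw [map_smul, hx, π.mem_vertexSpace.1 (hB k)]⟩
  choose m hm hmB using hm
  refine ⟨π.projModule c, inferInstance, inferInstance, inferInstance, inferInstance,
    π.projLift c m, finite_submodule _, π.isProjectiveCover_projLift hJ c m hm B hmB, fun b => ?_⟩
  rw [← hc]
  exact π.le_dimVec_radModule_projModule hJ c b

include hJ in
-- Converse to `exists_of_embedsInto`. The line through `m` is simple and avoids `J M`, hence is a
-- direct summand. The explicit cover of its complement has the largest possible radical, and
-- modules killed by the arrows embed as soon as their dimension vectors allow it.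
theorem exists_embedsInto [Module.Finite K M] {v : V} {m : M} (hm : m ∈ π.vertexSpace M v)
    (hk : ∀ (b : V) (α : v ⟶ b), π.arrow α • m = 0) (hr : m ∉ radModule Λ M)
    (hd : ∀ b, π.dimVec (radModule Λ M) b + (Pi.single v 1 : V → ℕ) b ≤
      ∑ a, Fintype.card (a ⟶ b) *
        (π.dimVec (M ⧸ radModule Λ M) a - (Pi.single v 1 : V → ℕ) a)) :
    ∃ N S : Submodule Λ M, IsCompl N S ∧ IsSimpleModule Λ S ∧
      ∃ (P : Type u₁) (_ : AddCommGroup P) (_ : Module Λ P) (f : P →ₗ[Λ] N),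
        IsProjectiveCover f ∧ EmbedsInto Λ (radModule Λ M × S) (radModule Λ P) := by
  have hm0 : m ≠ 0 := fun h => hr (h ▸ zero_mem _)
  set S := Submodule.span Λ {m} with hSdef
  have hSs : IsSimpleModule Λ S := π.isSimpleModule_span_singleton hJ hm hm0 hk
  have hdisj : S ⊓ radModule Λ M = ⊥ := by
    rw [eq_bot_iff]
    rintro x ⟨hxS, hxr⟩
    obtain ⟨r, rfl⟩ := Submodule.mem_span_singleton.1 hxS
    obtain ⟨c, hc⟩ := π.exists_smul_eq_smul hJ hm hk r
    rw [hc] at hxr ⊢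
    by_cases hc0 : c = 0
    · rw [hc0, zero_smul]; exact zero_mem _
    · exact absurd (((radModule Λ M).restrictScalars K).smul_mem_iff hc0 |>.1 hxr) hr
  have := (π.isKilled_quotient_radModule M).isSemisimpleModule hJ
  -- The complement of `S` in `M` is the preimage of a complement in the semisimple top.
  obtain ⟨C, hC⟩ := exists_isCompl (S.map (radModule Λ M).mkQ)
  have hcompl : IsCompl (C.comap (radModule Λ M).mkQ) S := by
    refine IsCompl.of_eq ?_ ?_
    · rw [eq_bot_iff]
      rintro x ⟨hx, hxS⟩
      rw [← hdisj]
      refine ⟨hxS, (Submodule.Quotient.mk_eq_zero _).1 ?_⟩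
      have h1 : (radModule Λ M).mkQ x ∈ S.map (radModule Λ M).mkQ ⊓ C := ⟨⟨x, hxS, rfl⟩, hx⟩
      rwa [hC.inf_eq_bot, Submodule.mem_bot] at h1
    · rw [eq_top_iff]
      rintro p -
      obtain ⟨_, ⟨k, hk, rfl⟩, c, hc, hkc⟩ := Submodule.mem_sup.1
        (hC.sup_eq_top.symm ▸ Submodule.mem_top : (radModule Λ M).mkQ p ∈ _ ⊔ C)
      refine Submodule.mem_sup.2 ⟨p - k, ?_, k, hk, sub_add_cancel _ _⟩
      rw [Submodule.mem_comap, map_sub, ← hkc, add_sub_cancel_left]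
      exact hc
  set N := C.comap (radModule Λ M).mkQ with hN
  have hS : π.IsKilled S := π.isKilled_of_isSemisimpleModule
  have hfN := finite_submodule (K := K) N
  have hfS := finite_submodule (K := K) S
  have hfR := finite_submodule (K := K) (radModule Λ M)
  obtain ⟨P, _, _, _, _, f, hfP, hf, hP⟩ := π.exists_projectiveCover hJ N
  have hfRP := finite_submodule (K := K) (radModule Λ P)
  have hSd : π.dimVec S = Pi.single v 1 := by
    obtain ⟨w, x, hx, hx0, hd⟩ := π.dimVec_of_isSimpleModule hJ (M := S)
    have : w = v := by
      by_contra hne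
      apply hx0
      obtain ⟨r, hr⟩ := Submodule.mem_span_singleton.1 x.2
      obtain ⟨c, hc⟩ := π.exists_smul_eq_smul hJ hm hk r
      have h1 := π.mem_vertexSpace.1 (π.coe_mem_vertexSpace.1 hx)
      rw [← hr, hc, smul_comm, π.idem_smul_of_ne hne hm, smul_zero] at h1
      refine Subtype.ext ?_
      rw [← hr, hc, ← h1]; rfl
    rw [hd, this]
  refine ⟨N, S, hcompl, hSs, P, inferInstance, inferInstance, f, hf, ?_⟩
  have hkill : π.IsKilled (radModule Λ M × S) := fun a b α x =>
    Prod.ext (π.isKilled_radModule hJ M a b α x.1) (hS a b α x.2)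
  refine hkill.exists_linearMap hJ (π.isKilled_radModule hJ P) fun b => ?_
  rw [dimVec_prod, hSd]
  refine ((hd b).trans_eq (Finset.sum_congr rfl fun a _ => ?_)).trans (hP b)
  rw [← π.dimVec_top_of_isCompl hJ hcompl hS a, hSd, Nat.add_sub_cancel]

end Existence

end AdmissiblePresentation

end

/-! ### Points of the variety and their modules. -/

noncomputable section

open Matrix

namespace RepSpace

variable {K : Type u} [Field K] {V : Type v} [Quiver.{w} V] {d : V → ℕ}

/-- All compositions of two consecutive arrows vanish. -/
def SqZero (x : RepSpace K d) : Prop :=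
  ∀ ⦃a b c : V⦄ (α : a ⟶ b) (β : b ⟶ c), x β * x α = 0

/-- The sum of the images of the arrows ending at a vertex. -/
def imSpace (x : RepSpace K d) (b : V) : Submodule K (Fin (d b) → K) :=
  ⨆ s : (Σ a, a ⟶ b), LinearMap.range (x s.2).mulVecLin

/-- The intersection of the kernels of the arrows starting at a vertex. -/
def socSpace (x : RepSpace K d) (a : V) : Submodule K (Fin (d a) → K) :=
  ⨅ s : (Σ b, a ⟶ b), LinearMap.ker (x s.2).mulVecLin

theorem mulVec_mem_imSpace (x : RepSpace K d) {a b : V} (α : a ⟶ b) (u : Fin (d a) → K) :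
    x α *ᵥ u ∈ x.imSpace b :=
  Submodule.mem_iSup_of_mem (⟨a, α⟩ : Σ a, a ⟶ b) ⟨u, rfl⟩

theorem imSpace_le {x : RepSpace K d} {b : V} {U : Submodule K (Fin (d b) → K)}
    (h : ∀ (a : V) (α : a ⟶ b) (u : Fin (d a) → K), x α *ᵥ u ∈ U) : x.imSpace b ≤ U :=
  iSup_le fun s => by rintro _ ⟨u, rfl⟩; exact h s.1 s.2 u

theorem mem_socSpace {x : RepSpace K d} {a : V} {u : Fin (d a) → K} :
    u ∈ x.socSpace a ↔ ∀ (b : V) (α : a ⟶ b), x α *ᵥ u = 0 := by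
  simp [socSpace, Sigma.forall]

theorem SqZero.imSpace_le_socSpace {x : RepSpace K d} (h : x.SqZero) (a : V) :
    x.imSpace a ≤ x.socSpace a :=
  imSpace_le fun b α u => mem_socSpace.2 fun c β => by
    rw [mulVec_mulVec, h α β, zero_mulVec]

end RepSpace

namespace AdmissiblePresentation

open PathAlgebra RepSpace

variable {K : Type u} [Field K] {V : Type v} [Quiver.{w} V] [Fintype V] [DecidableEq V]
  {Λ : Type u₁} [Ring Λ] [Algebra K Λ] (π : AdmissiblePresentation K V Λ) {d : V → ℕ}
variable (hJ : Ring.jacobson Λ ^ 2 = ⊥)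

omit [Algebra K Λ] [Ring Λ] in
theorem evalRep_ofPath (x : RepSpace K d) {a b : V} (p : Quiver.Path a b) :
    evalRep x (ofPath K p) = pathEnd x p :=
  PathAlgebra.lift_ofPath K _ p

include π hJ in
-- Paths of length two vanish in `Λ` because `J ^ 2 = 0`, so they are among the relations.
theorem sqZero (x : π.RepVariety d) : x.1.SqZero := by
  intro a b c α β
  have h := x.2 (ofPath K ((Quiver.Path.nil.cons α).cons β))
    (π.map_ofPath_eq_zero hJ _ (by simp))
  rw [evalRep_ofPath] at h
  refine Matrix.toLin'.injective (LinearMap.ext fun u => ?_)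
  have h1 := congrFun (LinearMap.congr_fun h (Pi.single a u)) c
  simpa [pathEnd, pathMap] using h1

omit [Algebra K Λ] [Ring Λ] in
-- Every path of length at least two ends with two consecutive arrows. As `I` is spanned inside such
-- paths, this and `sqZero` identify `Rep_d(Λ)` with the square-zero families.
theorem evalRep_eq_zero_of_sqZero {x : RepSpace K d} (hx : x.SqZero) {r : PathAlgebra K V}
    (hr : r ∈ arrowPower K 2) : evalRep x r = 0 := by
  have hle : arrowPower K (V := V) 2 ≤ LinearMap.ker (evalRep x).toLinearMap := by
    refine Submodule.span_le.2 ?_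
    rintro _ ⟨a, b, p, hp, rfl⟩
    change evalRep x _ = 0
    rw [evalRep_ofPath]
    cases p with
    | nil => simp at hp
    | cons p α =>
      cases p with
      | nil => simp at hp
      | cons p β =>
        refine LinearMap.ext fun u => ?_
        simp [pathEnd, pathMap, hx β α]
  exact hle hr

/-- The point of `Rep_d(Λ)` given by a family of matrices with vanishing compositions. -/
def repOfSqZero (x : RepSpace K d) (hx : x.SqZero) : π.RepVariety d :=
  ⟨x, fun _ hr => evalRep_eq_zero_of_sqZero hx (π.mem_arrowPower_two_of_map_eq_zero hr)⟩

section RepModule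

variable (x : π.RepVariety d)

instance : Module K (π.RepModule x) := inferInstanceAs (Module K (VecSpace K d))

instance : IsScalarTower K Λ (π.RepModule x) := by
  refine ⟨fun c r m => ?_⟩
  obtain ⟨r, rfl⟩ := π.surjective r
  change π.action x (c • π.toAlgHom r) m = c • π.action x (π.toAlgHom r) m
  rw [← map_smul, action_apply, action_apply, map_smul]
  rfl

/-- The underlying vector space of `M(x)`. -/
def toVec : π.RepModule x ≃ₗ[K] VecSpace K d := LinearEquiv.refl K (VecSpace K d)

instance : Module.Finite K (π.RepModule x) :=
  Module.Finite.equiv (π.toVec x).symm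

theorem toVec_smul_ofPath {a b : V} (p : Quiver.Path a b) (m : π.RepModule x) :
    π.toVec x (π.toAlgHom (ofPath K p) • m) = Pi.single b (pathMap x.1 p (π.toVec x m a)) := by
  change π.action x (π.toAlgHom (ofPath K p)) m = _
  rw [action_apply, evalRep_ofPath]
  rfl

theorem toVec_idem_smul (a : V) (m : π.RepModule x) :
    π.toVec x (π.idem a • m) = Pi.single a (π.toVec x m a) :=
  π.toVec_smul_ofPath x _ m

theorem toVec_arrow_smul {a b : V} (α : a ⟶ b) (m : π.RepModule x) :
    π.toVec x (π.arrow α • m) = Pi.single b (x.1 α *ᵥ π.toVec x m a) :=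
  π.toVec_smul_ofPath x _ m

/-- The embedding of the component at a vertex. -/
def ofVertex (a : V) : (Fin (d a) → K) →ₗ[K] π.RepModule x :=
  (π.toVec x).symm.toLinearMap ∘ₗ LinearMap.single K (fun i : V => Fin (d i) → K) a

theorem toVec_ofVertex (a : V) (u : Fin (d a) → K) :
    π.toVec x (π.ofVertex x a u) = Pi.single a u := rfl

theorem ofVertex_injective (a : V) : Function.Injective (π.ofVertex x a) :=
  fun _ _ h => Pi.single_injective (M := fun i : V => Fin (d i) → K) a h

theorem ofVertex_mem (a : V) (u : Fin (d a) → K) :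
    π.ofVertex x a u ∈ π.vertexSpace (π.RepModule x) a := by
  rw [mem_vertexSpace]
  apply (π.toVec x).injective
  rw [toVec_idem_smul, toVec_ofVertex, Pi.single_eq_same]

theorem eq_ofVertex {a : V} {m : π.RepModule x} (hm : m ∈ π.vertexSpace (π.RepModule x) a) :
    m = π.ofVertex x a (π.toVec x m a) := by
  apply (π.toVec x).injective
  rw [toVec_ofVertex, ← toVec_idem_smul, π.mem_vertexSpace.1 hm]

theorem arrow_smul_ofVertex {a b : V} (α : a ⟶ b) (u : Fin (d a) → K) :
    π.arrow α • π.ofVertex x a u = π.ofVertex x b (x.1 α *ᵥ u) := by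
  apply (π.toVec x).injective
  rw [toVec_arrow_smul, toVec_ofVertex, toVec_ofVertex, Pi.single_eq_same]

theorem dimVec_repModule (a : V) : π.dimVec (π.RepModule x) a = d a := by
  have h : LinearMap.range (π.ofVertex x a) = π.vertexSpace (π.RepModule x) a := by
    ext m
    refine ⟨?_, fun hm => ⟨_, (π.eq_ofVertex x hm).symm⟩⟩
    rintro ⟨u, rfl⟩
    exact π.ofVertex_mem x a u
  rw [dimVec_eq, ← h, LinearMap.finrank_range_of_inj (π.ofVertex_injective x a), Module.finrank_pi,
    Fintype.card_fin]

variable [∀ a b : V, Fintype (a ⟶ b)]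

include hJ in
-- The part of `J M(x)` at `a` consists of sums of vectors reached by arrows into `a`, since `J` is
-- spanned by arrows.
theorem ofVertex_mem_radModule {a : V} {u : Fin (d a) → K} :
    π.ofVertex x a u ∈ radModule Λ (π.RepModule x) ↔ u ∈ x.1.imSpace a := by
  constructor
  · intro h
    obtain ⟨w, hw⟩ := π.exists_idem_smul_eq_sum hJ h a
    have h1 := congrFun (congrArg (π.toVec x) hw) a
    rw [toVec_idem_smul, toVec_ofVertex, Pi.single_eq_same, Pi.single_eq_same, map_sum,
      Finset.sum_apply] at h1
    rw [h1]
    refine Submodule.sum_mem _ fun p _ => ?_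
    rw [toVec_arrow_smul, Pi.single_eq_same]
    exact x.1.mulVec_mem_imSpace p.2 _
  · have : x.1.imSpace a ≤
        ((radModule Λ (π.RepModule x)).restrictScalars K).comap (π.ofVertex x a) := by
      refine imSpace_le fun b α u => ?_
      change π.ofVertex x a _ ∈ radModule Λ (π.RepModule x)
      rw [← arrow_smul_ofVertex]
      exact π.arrow_smul_mem_radModule α _
    exact fun h => this h

include hJ in
theorem dimVec_radModule_repModule (a : V) :
    π.dimVec (radModule Λ (π.RepModule x)) a = Module.finrank K (x.1.imSpace a) := by
  let g : x.1.imSpace a →ₗ[K] π.RepModule x := π.ofVertex x a ∘ₗ Submodule.subtype _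
  let h : π.vertexSpace (radModule Λ (π.RepModule x)) a →ₗ[K] π.RepModule x :=
    (radModule Λ (π.RepModule x)).subtype.restrictScalars K ∘ₗ Submodule.subtype _
  have hg : Function.Injective g := (π.ofVertex_injective x a).comp Subtype.val_injective
  have hh : Function.Injective h := Subtype.val_injective.comp Subtype.val_injective
  have hgh : LinearMap.range g = LinearMap.range h := by
    ext m
    constructor
    · rintro ⟨u, rfl⟩
      exact ⟨⟨⟨_, (π.ofVertex_mem_radModule hJ x).2 u.2⟩,
        π.coe_mem_vertexSpace.2 (π.ofVertex_mem x a u)⟩, rfl⟩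
    · rintro ⟨m, rfl⟩
      have h1 := π.eq_ofVertex x (π.coe_mem_vertexSpace.1 m.2)
      refine ⟨⟨π.toVec x m.1.1 a, ?_⟩, h1.symm⟩
      rw [← π.ofVertex_mem_radModule hJ x, ← h1]
      exact m.1.2
  rw [dimVec_eq, ← LinearMap.finrank_range_of_inj hg, hgh, LinearMap.finrank_range_of_inj hh]

include hJ in
-- The top of `M(x)` and `T` are both killed by the arrows, so they are isomorphic once their
-- dimension vectors agree. This makes `Rep_d^T` a stratum.
theorem hasTop_repModule_iff (T : Type*) [AddCommGroup T] [Module K T] [Module Λ T]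
    [IsScalarTower K Λ T] [Module.Finite K T] [IsSemisimpleModule Λ T] :
    HasTop Λ (π.RepModule x) T ↔
      ∀ a, π.dimVec T a + Module.finrank K (x.1.imSpace a) = d a := by
  have h1 : ∀ a, π.dimVec (π.RepModule x ⧸ radModule Λ (π.RepModule x)) a +
      Module.finrank K (x.1.imSpace a) = d a := by
    intro a
    rw [← π.dimVec_radModule_repModule hJ x, dimVec_quotient_add, dimVec_repModule]
  have hfin := finite_quotient (K := K) (radModule Λ (π.RepModule x))
  constructor
  · rintro ⟨e⟩ a
    rw [← π.dimVec_congr e, h1]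
  · intro h
    refine (π.isKilled_quotient_radModule _).nonempty_linearEquiv hJ
      π.isKilled_of_isSemisimpleModule fun a => ?_
    have h2 := h a
    have h3 := h1 a
    omega

end RepModule

include hJ in
/-- Every finite dimensional module is given by a point of the variety of its dimension vector. -/
theorem exists_repModule_equiv (M : Type*) [AddCommGroup M] [Module K M] [Module Λ M]
    [IsScalarTower K Λ M] [Module.Finite K M] (hd : π.dimVec M = d) :
    ∃ x : π.RepVariety d, Nonempty (M ≃ₗ[Λ] π.RepModule x) := by
  have hψ : ∀ a, Nonempty (π.vertexSpace M a ≃ₗ[K] (Fin (d a) → K)) := fun a =>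
    FiniteDimensional.nonempty_linearEquiv_of_finrank_eq (by
      rw [Module.finrank_pi, Fintype.card_fin, ← hd]; rfl)
  have ψ := fun a => (hψ a).some
  let A : ∀ {a b : V} (α : a ⟶ b), π.vertexSpace M a →ₗ[K] π.vertexSpace M b := fun {a b} α =>
    ((Algebra.lsmul K K M (π.arrow α)).codRestrict (π.vertexSpace M b)
      fun m => π.arrow_smul_mem α m) ∘ₗ Submodule.subtype _
  let x : RepSpace K d := fun a b α =>
    LinearMap.toMatrix' ((ψ b).toLinearMap ∘ₗ A α ∘ₗ (ψ a).symm.toLinearMap)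
  have hxα : ∀ {a b : V} (α : a ⟶ b) u, x α *ᵥ u = ψ b (A α ((ψ a).symm u)) := fun α u => by
    rw [← Matrix.toLin'_apply]
    simp [x]
  have hx : x.SqZero := by
    intro a b c α β
    refine Matrix.toLin'.injective (LinearMap.ext fun u => ?_)
    rw [Matrix.toLin'_apply, ← mulVec_mulVec, hxα, hxα, LinearEquiv.symm_apply_apply, map_zero,
      LinearMap.zero_apply, LinearEquiv.map_eq_zero_iff]
    refine Subtype.ext ?_
    change π.arrow β • π.arrow α • _ = (0 : M)
    rw [← mul_smul, π.arrow_mul_arrow hJ, zero_smul]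
  let X := π.repOfSqZero x hx
  refine ⟨X, ?_⟩
  let F : M ≃ₗ[K] π.RepModule X :=
    ((π.vertexEquiv M).trans (LinearEquiv.piCongrRight ψ)).trans (π.toVec X).symm
  have hF : ∀ m a, π.toVec X (F m) a = ψ a ⟨π.idem a • m, π.idem_smul_mem a m⟩ := fun m a => rfl
  refine ⟨LinearEquiv.ofBijective (π.linearMapOfGenerators hJ F.toLinearMap ?_ ?_) F.bijective⟩
  · intro c m
    apply (π.toVec X).injective
    funext a
    change π.toVec X (F _) a = π.toVec X (π.idem c • F m) a
    rw [hF, toVec_idem_smul]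
    by_cases h : a = c
    · subst h
      rw [Pi.single_eq_same, hF]
      congr 2
      rw [← mul_smul, idem_mul_idem_self]
    · rw [Pi.single_eq_of_ne h, LinearEquiv.map_eq_zero_iff]
      exact Subtype.ext (π.idem_smul_of_ne h (π.idem_smul_mem c m))
  · intro c b α m
    apply (π.toVec X).injective
    funext a
    change π.toVec X (F _) a = π.toVec X (π.arrow α • F m) a
    rw [hF, toVec_arrow_smul]
    by_cases h : a = b
    · subst h
      rw [Pi.single_eq_same, hF]
      change _ = x α *ᵥ _
      rw [hxα, LinearEquiv.symm_apply_apply]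
      refine congrArg (ψ a) (Subtype.ext ?_)
      change π.idem a • π.arrow α • m = π.arrow α • π.idem c • m
      rw [arrow_smul_idem_smul, ← mul_smul, idem_mul_arrow]
    · rw [Pi.single_eq_of_ne h, LinearEquiv.map_eq_zero_iff]
      exact Subtype.ext (π.idem_smul_of_ne h (π.arrow_smul_mem α m))

end AdmissiblePresentation

end

/-! ### Semicontinuity, polynomial curves and irreducibility of the strata. -/

noncomputable section

open Matrix Polynomial Topology

section LinearAlgebra

variable {K : Type*} [Field K]

/-- Subspaces of the same dimension are related by an automorphism. -/
theorem exists_linearEquiv_map_eq {E : Type*} [AddCommGroup E] [Module K E] [Module.Finite K E]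
    {U W : Submodule K E} (h : Module.finrank K U = Module.finrank K W) :
    ∃ e : E ≃ₗ[K] E, U.map e.toLinearMap = W := by
  obtain ⟨U', hU⟩ := exists_isCompl U
  obtain ⟨W', hW⟩ := exists_isCompl W
  have h' : Module.finrank K U' = Module.finrank K W' := by
    have h1 := Submodule.finrank_add_eq_of_isCompl hU
    have h2 := Submodule.finrank_add_eq_of_isCompl hW
    omega
  let e₁ := LinearEquiv.ofFinrankEq U W h
  let e₂ := LinearEquiv.ofFinrankEq U' W' h'
  let e := ((Submodule.prodEquivOfIsCompl U U' hU).symm.trans (e₁.prodCongr e₂)).trans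
    (Submodule.prodEquivOfIsCompl W W' hW)
  have he : ∀ u : U, e u = e₁ u := by
    intro u
    simp [e]
  refine ⟨e, le_antisymm ?_ fun x hx => ?_⟩
  · rintro _ ⟨u, hu, rfl⟩
    exact (he ⟨u, hu⟩).symm ▸ (e₁ ⟨u, hu⟩).2
  · refine ⟨e₁.symm ⟨x, hx⟩, (e₁.symm ⟨x, hx⟩).2, ?_⟩
    exact (he _).trans (by rw [LinearEquiv.apply_symm_apply])

/-- Determinants after multiplication by arbitrary constant matrices replace minors: no rows or
columns have to be selected, and the expression is still polynomial in `A`. -/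
theorem Matrix.le_rank_iff {m n : Type*} [Fintype m] [Fintype n] [DecidableEq m] [DecidableEq n]
    (A : Matrix m n K) (k : ℕ) :
    k ≤ A.rank ↔ ∃ (B : Matrix (Fin k) m K) (D : Matrix n (Fin k) K), (B * A * D).det ≠ 0 := by
  constructor
  · intro h
    obtain ⟨f, hf⟩ := finrank_le_iff_exists_linearMap (R := K) (M := Fin k → K)
      (M' := LinearMap.range A.mulVecLin) |>.1 (by rwa [Module.finrank_pi, Fintype.card_fin])
    obtain ⟨g, hg⟩ := A.mulVecLin.rangeRestrict.exists_rightInverse_of_surjective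
      A.mulVecLin.range_rangeRestrict
    have hAC : A.mulVecLin ∘ₗ g ∘ₗ f = Submodule.subtype _ ∘ₗ f := by
      refine LinearMap.ext fun u => ?_
      exact congrArg Subtype.val (LinearMap.congr_fun hg (f u))
    have hinj : LinearMap.ker (A.mulVecLin ∘ₗ g ∘ₗ f) = ⊥ := by
      rw [hAC, LinearMap.ker_eq_bot]
      exact Subtype.val_injective.comp hf
    obtain ⟨l, hl⟩ := LinearMap.exists_leftInverse_of_injective _ hinj
    refine ⟨LinearMap.toMatrix' l, LinearMap.toMatrix' (g ∘ₗ f), ?_⟩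
    have : LinearMap.toMatrix' l * A * LinearMap.toMatrix' (g ∘ₗ f) = 1 := by
      apply Matrix.toLin'.injective
      rw [Matrix.toLin'_mul, Matrix.toLin'_mul, Matrix.toLin'_toMatrix', Matrix.toLin'_toMatrix',
        Matrix.toLin'_one]
      exact hl
    rw [this, Matrix.det_one]
    exact one_ne_zero
  · rintro ⟨B, D, h⟩
    have h1 : (B * A * D).rank = k := by
      rw [Matrix.rank_of_isUnit _ ((Matrix.isUnit_iff_isUnit_det _).2 h.isUnit), Fintype.card_fin]
    calc k = (B * A * D).rank := h1.symm
      _ ≤ (B * A).rank := Matrix.rank_mul_le_left _ _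
      _ ≤ A.rank := Matrix.rank_mul_le_right _ _

end LinearAlgebra

theorem isClosed_zariskiTopology_iff {K : Type*} [Field K] {σ : Type*} {Z : Set (σ → K)} :
    IsClosed[zariskiTopology K σ] Z ↔
      ∃ E : Set (MvPolynomial σ K), Z = {x | ∀ p ∈ E, MvPolynomial.eval x p = 0} := by
  rw [← @isOpen_compl_iff _ _ (zariskiTopology K σ)]
  change Zᶜᶜ ∈ _ ↔ _
  rw [compl_compl]
  rfl

namespace RepSpace

variable {K : Type u} [Field K] {V : Type v} [Quiver.{w} V] [Fintype V] [DecidableEq V]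
  [∀ a b : V, Fintype (a ⟶ b)] {d : V → ℕ}

/-- The index set of the coordinates of a point. -/
abbrev CoordIndex {V : Type v} [Quiver.{w} V] (d : V → ℕ) : Type (max v w) :=
  Σ a b : V, (a ⟶ b) × Fin (d b) × Fin (d a)

/-- The matrix whose columns are the columns of all arrows ending at a vertex. -/
def imMatrix {R : Type*} (x : RepSpace R d) (b : V) :
    Matrix (Fin (d b)) (Σ s : (Σ a, a ⟶ b), Fin (d s.1)) R :=
  Matrix.of fun i t => x t.1.2 i t.2

/-- The matrix whose rows are the rows of all arrows starting at a vertex. -/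
def socMatrix {R : Type*} (x : RepSpace R d) (a : V) :
    Matrix (Σ s : (Σ b, a ⟶ b), Fin (d s.1)) (Fin (d a)) R :=
  Matrix.of fun t j => x t.1.2 t.2 j

omit [DecidableEq V] in
theorem rank_imMatrix (x : RepSpace K d) (b : V) :
    (x.imMatrix b).rank = Module.finrank K (x.imSpace b) := by
  classical
  have h : LinearMap.range (x.imMatrix b).mulVecLin = x.imSpace b := by
    rw [Matrix.range_mulVecLin]
    refine le_antisymm (Submodule.span_le.2 ?_) (imSpace_le fun a α u => ?_)
    · rintro _ ⟨t, rfl⟩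
      have : (x.imMatrix b).col t = x t.1.2 *ᵥ Pi.single t.2 1 := by
        rw [Matrix.mulVec_single_one]; rfl
      rw [this]
      exact x.mulVec_mem_imSpace _ _
    · rw [Matrix.mulVec_eq_sum]
      refine Submodule.sum_mem _ fun j _ => ?_
      rw [op_smul_eq_smul]
      exact Submodule.smul_mem _ _ (Submodule.subset_span
        ⟨(⟨⟨a, α⟩, j⟩ : Σ s : (Σ a, a ⟶ b), Fin (d s.1)), rfl⟩)
  rw [Matrix.rank, h]

omit [Fintype V] [DecidableEq V] [∀ a b : V, Fintype (a ⟶ b)] in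
theorem rank_socMatrix (x : RepSpace K d) (a : V) :
    (x.socMatrix a).rank + Module.finrank K (x.socSpace a) = d a := by
  have h : LinearMap.ker (x.socMatrix a).mulVecLin = x.socSpace a := by
    ext u
    rw [LinearMap.mem_ker, mem_socSpace, Matrix.mulVecLin_apply]
    constructor
    · intro hu b α
      funext i
      exact congrFun hu (⟨⟨b, α⟩, i⟩ : Σ s : (Σ b, a ⟶ b), Fin (d s.1))
    · intro hu
      funext t
      exact congrFun (hu t.1.1 t.1.2) t.2
  have h1 := (x.socMatrix a).mulVecLin.finrank_range_add_finrank_ker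
  rw [h] at h1
  simpa [Matrix.rank] using h1

/-- The point with indeterminate coordinates. -/
def generic (K : Type u) [Field K] {V : Type v} [Quiver.{w} V] (d : V → ℕ) :
    RepSpace (MvPolynomial (CoordIndex d) K) d :=
  fun a b α => Matrix.of fun i j => MvPolynomial.X ⟨a, b, α, i, j⟩

end RepSpace

namespace AdmissiblePresentation

open PathAlgebra RepSpace

variable {K : Type u} [Field K] {V : Type v} [Quiver.{w} V] [Fintype V] [DecidableEq V]
  {Λ : Type u₁} [Ring Λ] [Algebra K Λ] (π : AdmissiblePresentation K V Λ) {d : V → ℕ}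
variable (hJ : Ring.jacobson Λ ^ 2 = ⊥)

theorem isClosed_iff {Z : Set (π.RepVariety d)} : IsClosed Z ↔
    ∃ E : Set (MvPolynomial (CoordIndex d) K),
      Z = {x | ∀ p ∈ E, MvPolynomial.eval (RepSpace.coords x.1) p = 0} := by
  refine (@isClosed_induced_iff _ _ (zariskiTopology K _) _ _).trans ?_
  constructor
  · rintro ⟨t, ht, rfl⟩
    obtain ⟨E, rfl⟩ := isClosed_zariskiTopology_iff.1 ht
    exact ⟨E, rfl⟩
  · rintro ⟨E, rfl⟩
    exact ⟨_, isClosed_zariskiTopology_iff.2 ⟨E, rfl⟩, rfl⟩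

/-- The determinants of `Matrix.le_rank_iff`, formed from the polynomial matrix `P`, are the
defining equations. -/
theorem isClosed_rank_lt {m n : Type*} [Fintype m] [Fintype n]
    (A : π.RepVariety d → Matrix m n K)
    (P : Matrix m n (MvPolynomial (CoordIndex d) K))
    (hA : ∀ x, A x = P.map (MvPolynomial.eval (RepSpace.coords x.1))) (k : ℕ) :
    IsClosed {x | (A x).rank < k} := by
  classical
  refine π.isClosed_iff.2 ⟨{p | ∃ (B : Matrix (Fin k) m K) (D : Matrix n (Fin k) K),
    p = (B.map (MvPolynomial.C : K →+* MvPolynomial (CoordIndex d) K) * P *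
      D.map (MvPolynomial.C : K →+* MvPolynomial (CoordIndex d) K)).det}, ?_⟩
  ext x
  have hdet : ∀ (B : Matrix (Fin k) m K) (D : Matrix n (Fin k) K),
      MvPolynomial.eval (RepSpace.coords x.1)
        (B.map (MvPolynomial.C : K →+* MvPolynomial (CoordIndex d) K) * P *
          D.map (MvPolynomial.C : K →+* MvPolynomial (CoordIndex d) K)).det = (B * A x * D).det := by
    intro B D
    rw [RingHom.map_det, RingHom.mapMatrix_apply, Matrix.map_mul, Matrix.map_mul, ← hA,
      Matrix.map_map, Matrix.map_map]
    congr 3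
    · ext i j; simp
    · ext i j; simp
  rw [Set.mem_ofPred_eq, Set.mem_ofPred_eq, ← not_le, Matrix.le_rank_iff]
  push Not
  constructor
  · rintro h _ ⟨B, D, rfl⟩
    rw [hdet, h]
  · intro h B D
    rw [← hdet]
    exact h _ ⟨B, D, rfl⟩

section Semicontinuity

variable [∀ a b : V, Fintype (a ⟶ b)]

theorem isClosed_finrank_imSpace_le (b : V) (k : ℕ) :
    IsClosed {x : π.RepVariety d | Module.finrank K (x.1.imSpace b) ≤ k} := by
  have h := π.isClosed_rank_lt (fun x : π.RepVariety d => x.1.imMatrix b)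
    ((generic K d).imMatrix b) (fun x => by ext i t; simp [imMatrix, generic, coords]) (k + 1)
  simpa only [rank_imMatrix, Nat.lt_succ_iff] using h

theorem isClosed_le_finrank_socSpace (a : V) (k : ℕ) :
    IsClosed {x : π.RepVariety d | k ≤ Module.finrank K (x.1.socSpace a)} := by
  have h := π.isClosed_rank_lt (fun x : π.RepVariety d => x.1.socMatrix a)
    ((generic K d).socMatrix a) (fun x => by ext i t; simp [socMatrix, generic, coords])
    -- By rank-nullity the condition is rank at most `d a - k`, written strictly. For `k > d a` the
    -- truncated bound is `0` and both sets are empty.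
    (d a + 1 - k)
  convert h using 1
  ext x
  have := x.1.rank_socMatrix a
  simp only [Set.mem_ofPred_eq]
  omega

end Semicontinuity

/-- A curve whose coordinates are polynomials in the parameter. -/
def IsPolyCurve (φ : K → π.RepVariety d) : Prop :=
  ∃ Φ : RepSpace K[X] d, ∀ (t : K) ⦃a b : V⦄ (α : a ⟶ b),
    (φ t).1 α = (Φ α).map (Polynomial.eval t)

variable {π} in
-- An equation of `Z`, pulled back along the curve, is a polynomial in one variable with infinitely
-- many roots.
theorem IsPolyCurve.mem_of_infinite {φ : K → π.RepVariety d} (hφ : π.IsPolyCurve φ)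
    {Z : Set (π.RepVariety d)} (hZ : IsClosed Z) (h : {t | φ t ∈ Z}.Infinite) (t : K) :
    φ t ∈ Z := by
  obtain ⟨Φ, hΦ⟩ := hφ
  obtain ⟨E, rfl⟩ := π.isClosed_iff.1 hZ
  let Q : CoordIndex d → K[X] :=
    fun s => Φ s.2.2.1 s.2.2.2.1 s.2.2.2.2
  have hev : ∀ p t, MvPolynomial.eval (RepSpace.coords (φ t).1) p =
      (MvPolynomial.aeval Q p).eval t := by
    intro p t
    have hc : RepSpace.coords (φ t).1 = fun s => (Q s).eval t := by
      funext s
      simp [RepSpace.coords, hΦ, Q]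
    rw [hc]
    induction p using MvPolynomial.induction_on with
    | C c => simp
    | add p q hp hq => simp [hp, hq]
    | mul_X p i hp => simp [hp]
  intro p hp
  rw [hev]
  have : MvPolynomial.aeval Q p = 0 := by
    refine Polynomial.eq_zero_of_infinite_isRoot _ (h.mono fun t ht => ?_)
    change (MvPolynomial.aeval Q p).eval t = 0
    rw [← hev]
    exact ht p hp
  rw [this, Polynomial.eval_zero]

variable {π} in
theorem IsPolyCurve.finite_setOf_mem {φ : K → π.RepVariety d} (hφ : π.IsPolyCurve φ)
    {Z : Set (π.RepVariety d)} (hZ : IsClosed Z) {t : K} (ht : φ t ∉ Z) : {t | φ t ∈ Z}.Finite := by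
  by_contra h
  exact ht (hφ.mem_of_infinite hZ h t)

/-- The points at which the radical has a given dimension vector. -/
def stratum (s : V → ℕ) : Set (π.RepVariety d) :=
  {x | ∀ a, Module.finrank K (x.1.imSpace a) = s a}

include hJ in
-- Automorphisms of the vertex spaces match the two radicals. After this base change both points are
-- families with images in `x.1.imSpace` that annihilate `x.1.imSpace`; such families form a linear
-- space, so a line joins them. A second line joins the identity to the base change, and using the
-- adjugate for its inverse keeps the curve polynomial, also at parameters where the base change
-- degenerates.
theorem exists_polyCurve {s : V → ℕ} {x y : π.RepVariety d} (hx : x ∈ π.stratum s)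
    (hy : y ∈ π.stratum s) : ∃ φ : K → π.RepVariety d, π.IsPolyCurve φ ∧ φ 0 = x ∧ φ 1 = y ∧
      ∀ t a, Module.finrank K ((φ t).1.imSpace a) ≤ s a := by
  have he : ∀ a, ∃ e : (Fin (d a) → K) ≃ₗ[K] (Fin (d a) → K),
      (x.1.imSpace a).map e.toLinearMap = y.1.imSpace a := fun a =>
    exists_linearEquiv_map_eq ((hx a).trans (hy a).symm)
  choose e he using he
  let g : ∀ a, Matrix (Fin (d a)) (Fin (d a)) K := fun a => LinearMap.toMatrix' (e a).toLinearMap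
  let g' : ∀ a, Matrix (Fin (d a)) (Fin (d a)) K := fun a =>
    LinearMap.toMatrix' (e a).symm.toLinearMap
  have hg : ∀ a u, g a *ᵥ u = e a u := fun a u => by rw [← Matrix.toLin'_apply]; simp [g]
  have hg' : ∀ a u, g' a *ᵥ u = (e a).symm u := fun a u => by rw [← Matrix.toLin'_apply]; simp [g']
  have hgg' : ∀ a, g a * g' a = 1 := fun a => by
    refine Matrix.toLin'.injective (LinearMap.ext fun u => ?_)
    rw [Matrix.toLin'_apply, ← mulVec_mulVec, hg, hg', LinearEquiv.apply_symm_apply]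
    simp
  have hdet : ∀ a, (g a).det ≠ 0 := fun a h => by
    have := congrArg Matrix.det (hgg' a)
    rw [Matrix.det_mul, h, zero_mul, Matrix.det_one] at this
    exact zero_ne_one this
  -- The scalar cancels the determinant that the adjugate contributes at `t = 1`.
  let z : RepSpace K d := fun a b α => (g a).det⁻¹ • (g' b * y.1 α * g a)
  let G : K → ∀ a, Matrix (Fin (d a)) (Fin (d a)) K := fun t a => (1 - t) • 1 + t • g a
  let A : K → RepSpace K d := fun t a b α => (1 - t) • x.1 α + t • z α
  have hAim : ∀ t {a b : V} (α : a ⟶ b) u, A t α *ᵥ u ∈ x.1.imSpace b := by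
    intro t a b α u
    simp only [A, z, add_mulVec, smul_mulVec]
    refine add_mem (Submodule.smul_mem _ _ (x.1.mulVec_mem_imSpace α u))
      (Submodule.smul_mem _ _ (Submodule.smul_mem _ _ ?_))
    rw [← mulVec_mulVec, ← mulVec_mulVec, hg']
    have h1 := y.1.mulVec_mem_imSpace α (g a *ᵥ u)
    rw [← he b] at h1
    obtain ⟨w, hw, hwy⟩ := h1
    rw [← hwy]
    simpa using hw
  have hAker : ∀ t {a b : V} (α : a ⟶ b) u, u ∈ x.1.imSpace a → A t α *ᵥ u = 0 := by
    intro t a b α u hu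
    simp only [A, z, add_mulVec, smul_mulVec]
    have h1 := mem_socSpace.1 ((π.sqZero hJ x).imSpace_le_socSpace a hu) b α
    have h2 : e a u ∈ y.1.imSpace a := he a ▸ ⟨u, hu, rfl⟩
    have h3 := mem_socSpace.1 ((π.sqZero hJ y).imSpace_le_socSpace a h2) b α
    rw [h1, ← mulVec_mulVec, ← mulVec_mulVec, hg, h3]
    simp
  let F : K → RepSpace K d := fun t a b α => G t b * A t α * (G t a).adjugate
  have hF : ∀ t, (F t).SqZero := by
    intro t a b c α β
    have h1 : A t β * A t α = 0 := by
      refine Matrix.toLin'.injective (LinearMap.ext fun u => ?_)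
      rw [Matrix.toLin'_apply, ← mulVec_mulVec, hAker t β _ (hAim t α u)]
      simp
    -- The inner factor `adjugate * G` is a scalar matrix, so the product reduces to `A t β * A t α
    -- = 0`.
    calc F t β * F t α
        = G t c * A t β * ((G t b).adjugate * G t b) * A t α * (G t a).adjugate := by
          simp only [F, Matrix.mul_assoc]
      _ = 0 := by
          rw [Matrix.adjugate_mul, Matrix.mul_smul, Matrix.mul_one, Matrix.smul_mul,
            Matrix.mul_assoc (G t c), h1]
          simp
  refine ⟨fun t => π.repOfSqZero (F t) (hF t), ?_, ?_, ?_, ?_⟩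
  · let G' : ∀ a, Matrix (Fin (d a)) (Fin (d a)) K[X] := fun a =>
      (1 - X : K[X]) • 1 + (X : K[X]) • (g a).map C
    refine ⟨fun a b α => G' b * ((1 - X : K[X]) • (x.1 α).map C + (X : K[X]) • (z α).map C) *
      (G' a).adjugate, fun t a b α => ?_⟩
    have hG' : ∀ a, (G' a).map (evalRingHom t) = G t a := by
      intro a
      ext i j
      by_cases h : i = j <;> simp [G', G, h] <;> ring
    have hA' : ((1 - X : K[X]) • (x.1 α).map C + (X : K[X]) • (z α).map C).map (evalRingHom t) =
        A t α := by
      ext i j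
      simp [A]
      ring
    change F t α = _
    rw [← coe_evalRingHom, Matrix.map_mul, Matrix.map_mul, hG', hA', ← RingHom.mapMatrix_apply,
      RingHom.map_adjugate, RingHom.mapMatrix_apply, hG']
  · refine Subtype.ext ?_
    funext a b α
    change F 0 α = x.1 α
    simp [F, G, A]
  · refine Subtype.ext ?_
    funext a b α
    change F 1 α = y.1 α
    have hg1 : ∀ a, G 1 a = g a := fun a => by simp [G]
    simp only [F, A, hg1, z, sub_self, zero_smul, zero_add, one_smul]
    rw [Matrix.mul_smul, Matrix.smul_mul]
    have h1 : g b * (g' b * y.1 α * g a) * (g a).adjugate =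
        g b * g' b * y.1 α * (g a * (g a).adjugate) := by simp only [Matrix.mul_assoc]
    rw [h1, hgg', Matrix.mul_adjugate, Matrix.one_mul, Matrix.mul_smul, Matrix.mul_one, smul_smul,
      inv_mul_cancel₀ (hdet a), one_smul]
  · intro t a
    have h1 : (F t).imSpace a ≤ (x.1.imSpace a).map (G t a).mulVecLin := by
      refine imSpace_le fun b α u => ?_
      refine ⟨_, hAim t α ((G t b).adjugate *ᵥ u), ?_⟩
      simp only [F, mulVecLin_apply, ← mulVec_mulVec]
    calc Module.finrank K ((F t).imSpace a) ≤ _ := Submodule.finrank_mono h1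
      _ ≤ Module.finrank K (x.1.imSpace a) := Submodule.finrank_map_le _ _
      _ = s a := hx a

variable [∀ a b : V, Fintype (a ⟶ b)]

include hJ in
-- Let two closed sets cover the stratum, and join a point outside the first to a point outside the
-- second by a polynomial curve. The curve meets each set for only finitely many parameters. It
-- leaves the stratum only where some image dimension drops, a closed condition that fails at `t =
-- 0`, so again finitely often. This is impossible over an infinite field.
theorem isPreirreducible_stratum [Infinite K] (s : V → ℕ) :
    IsPreirreducible (π.stratum s : Set (π.RepVariety d)) := by
  rw [isPreirreducible_iff_isClosed_union_isClosed]
  intro z₁ z₂ hz₁ hz₂ hsub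
  by_contra! h
  obtain ⟨⟨x, hx, hx1⟩, ⟨y, hy, hy2⟩⟩ := And.imp Set.not_subset.1 Set.not_subset.1 h
  obtain ⟨φ, hφ, rfl, rfl, hle⟩ := π.exists_polyCurve hJ hx hy
  let Z : V → Set (π.RepVariety d) := fun a =>
    {x | Module.finrank K (x.1.imSpace a) + 1 ≤ s a}
  have hZ : ∀ a, {t | φ t ∈ Z a}.Finite := by
    intro a
    -- The bound `≤ s a - 1` expresses a drop only if `s a` is nonzero; otherwise no drop is
    -- possible.
    by_cases hs : s a = 0
    · convert Set.finite_empty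
      ext t
      simp [Z, hs]
    · have hcl : IsClosed (Z a) := by
        convert π.isClosed_finrank_imSpace_le a (s a - 1) using 1
        ext x
        simp only [Z, Set.mem_ofPred_eq]
        omega
      refine hφ.finite_setOf_mem hcl (t := 0) ?_
      have := hx a
      simp only [Z, Set.mem_ofPred_eq]
      omega
  have hfin := ((hφ.finite_setOf_mem hz₁ hx1).union (hφ.finite_setOf_mem hz₂ hy2)).union
    (Set.finite_iUnion hZ)
  refine Set.infinite_univ (hfin.subset fun t _ => ?_)
  by_cases ht : φ t ∈ π.stratum s
  · exact Or.inl (hsub ht)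
  · right
    obtain ⟨a, ha⟩ := not_forall.1 ht
    exact Set.mem_iUnion.2 ⟨a, lt_of_le_of_ne (hle t a) ha⟩

end AdmissiblePresentation

end

/-! ### Deforming a simple summand into the radical. -/

noncomputable section

open Matrix Polynomial Topology

namespace RepSpace

variable {K : Type u} [Field K] {V : Type v} [Quiver.{w} V] [Fintype V] [DecidableEq V]
  [∀ a b : V, Fintype (a ⟶ b)] {d : V → ℕ}

/-- A relation among the images of the arrows ending at a vertex is detected by functionals. -/
theorem exists_functional (x : RepSpace K d) (v : V) (U : ∀ a, Submodule K (Fin (d a) → K))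
    (hU : ∀ {a : V} (α : a ⟶ v), U a ≤ LinearMap.ker (x α).mulVecLin)
    (hlt : Module.finrank K (x.imSpace v) <
      ∑ a, Fintype.card (a ⟶ v) * Module.finrank K ((Fin (d a) → K) ⧸ U a)) :
    ∃ η : ∀ a, (a ⟶ v) → ((Fin (d a) → K) →ₗ[K] K), (∀ a α, ∀ u ∈ U a, η a α u = 0) ∧
      ∃ u : ∀ p : (Σ a, a ⟶ v), Fin (d p.1) → K,
        ∑ p, x p.2 *ᵥ u p = 0 ∧ ∑ p : (Σ a, a ⟶ v), η p.1 p.2 (u p) ≠ 0 := by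
  classical
  -- The arrows into `v` factor through the quotients by `U`. The sum of the induced maps lands in
  -- `imSpace v`, which is too small for this sum to be injective.
  let L : ∀ p : (Σ a, a ⟶ v), ((Fin (d p.1) → K) ⧸ U p.1) →ₗ[K] (Fin (d v) → K) := fun p =>
    (U p.1).liftQ (x p.2).mulVecLin (hU p.2)
  let Ψ : (∀ p : (Σ a, a ⟶ v), (Fin (d p.1) → K) ⧸ U p.1) →ₗ[K] (Fin (d v) → K) :=
    ∑ p, L p ∘ₗ LinearMap.proj (φ := fun p : (Σ a, a ⟶ v) => (Fin (d p.1) → K) ⧸ U p.1) p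
  have hΨ : ∀ u : ∀ p : (Σ a, a ⟶ v), Fin (d p.1) → K,
      Ψ (fun p => (U p.1).mkQ (u p)) = ∑ p, x p.2 *ᵥ u p := by
    intro u
    simp only [Ψ, LinearMap.sum_apply, LinearMap.comp_apply, LinearMap.proj_apply]
    rfl
  have hsurj : ∀ w : (∀ p : (Σ a, a ⟶ v), (Fin (d p.1) → K) ⧸ U p.1),
      ∃ u : ∀ p : (Σ a, a ⟶ v), Fin (d p.1) → K, w = fun p => (U p.1).mkQ (u p) := by
    intro w
    choose u hu using fun p : (Σ a, a ⟶ v) => (U p.1).mkQ_surjective (w p)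
    exact ⟨u, funext fun p => (hu p).symm⟩
  have hrange : LinearMap.range Ψ ≤ x.imSpace v := by
    rintro _ ⟨w, rfl⟩
    obtain ⟨u, rfl⟩ := hsurj w
    rw [hΨ]
    exact Submodule.sum_mem _ fun p _ => x.mulVec_mem_imSpace p.2 _
  have hker : LinearMap.ker Ψ ≠ ⊥ := by
    intro h
    have h1 := Ψ.finrank_range_add_finrank_ker
    rw [h, finrank_bot, add_zero, Module.finrank_pi_fintype] at h1
    have h2 := Submodule.finrank_mono hrange
    have h3 : ∑ p : (Σ a, a ⟶ v), Module.finrank K ((Fin (d p.1) → K) ⧸ U p.1) =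
        ∑ a, Fintype.card (a ⟶ v) * Module.finrank K ((Fin (d a) → K) ⧸ U a) := by
      rw [Fintype.sum_sigma]
      refine Finset.sum_congr rfl fun a _ => ?_
      change ∑ _ : (a ⟶ v), Module.finrank K ((Fin (d a) → K) ⧸ U a) = _
      rw [Finset.sum_const, Finset.card_univ, smul_eq_mul]
    omega
  obtain ⟨w, hw, hw0⟩ := (Submodule.ne_bot_iff _).1 hker
  -- The components of a single functional that detects the kernel vector `w` are the required `η`.
  obtain ⟨η₀, hη₀⟩ : ∃ η₀ : Module.Dual K _, η₀ w ≠ 0 := by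
    by_contra! h
    exact hw0 ((Module.forall_dual_apply_eq_zero_iff K w).1 h)
  obtain ⟨u, rfl⟩ := hsurj w
  refine ⟨fun a α => η₀ ∘ₗ LinearMap.single K
    (fun p : (Σ a, a ⟶ v) => (Fin (d p.1) → K) ⧸ U p.1) ⟨a, α⟩ ∘ₗ (U a).mkQ, ?_, u, ?_, ?_⟩
  · intro a α u hu
    have : (U a).mkQ u = 0 := (Submodule.Quotient.mk_eq_zero _).2 hu
    rw [LinearMap.comp_apply, LinearMap.comp_apply, this, map_zero, map_zero]
  · rw [← hΨ]; exact hw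
  · convert hη₀
    conv_rhs => rw [← Finset.univ_sum_single (fun p : (Σ a, a ⟶ v) => (U p.1).mkQ (u p)), map_sum]
    rfl

end RepSpace

namespace AdmissiblePresentation

open PathAlgebra RepSpace

variable {K : Type u} [Field K] {V : Type v} [Quiver.{w} V] [Fintype V] [DecidableEq V]
  {Λ : Type u₁} [Ring Λ] [Algebra K Λ] (π : AdmissiblePresentation K V Λ) {d : V → ℕ}
variable (hJ : Ring.jacobson Λ ^ 2 = ⊥) [∀ a b : V, Fintype (a ⟶ b)]

include hJ in
/-- A simple direct summand can be absorbed into the radical by a deformation, if there is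
room for it. -/
theorem mem_closure_stratum [Infinite K] {s : V → ℕ} {x : π.RepVariety d} (hx : x ∈ π.stratum s)
    {v : V} {m : Fin (d v) → K} (hm : m ∈ x.1.socSpace v) (hm' : m ∉ x.1.imSpace v)
    (hs : s v + 1 ≤ ∑ a, Fintype.card (a ⟶ v) * (d a - s a - (Pi.single v 1 : V → ℕ) a)) :
    x ∈ closure (π.stratum (s + Pi.single v 1)) := by
  classical
  have hsq := π.sqZero hJ x
  -- Extending `m` by zero gives formulas uniform in the vertex; `U` below is the radical intended
  -- after the deformation.
  let m' : VecSpace K d := Pi.single v m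
  have hmv : m' v = m := Pi.single_eq_same _ _
  have hmne : ∀ a, a ≠ v → m' a = 0 := fun a h => Pi.single_eq_of_ne h _
  have hmsoc : ∀ a, m' a ∈ x.1.socSpace a := fun a => by
    by_cases h : a = v
    · subst h; rwa [hmv]
    · rw [hmne a h]; exact zero_mem _
  let U : ∀ a, Submodule K (Fin (d a) → K) := fun a => x.1.imSpace a ⊔ Submodule.span K {m' a}
  have hU : ∀ a, Module.finrank K (U a) = (s + Pi.single v 1 : V → ℕ) a := fun a => by
    by_cases h : a = v
    · subst h
      have hUa : U a = x.1.imSpace a ⊔ Submodule.span K {m} := by simp only [U, hmv]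
      rw [hUa, Submodule.finrank_sup_span_singleton hm', hx a, Pi.add_apply, Pi.single_eq_same]
    · have hUa : U a = x.1.imSpace a := by
        simp only [U, hmne a h, Submodule.span_zero_singleton, sup_bot_eq]
      rw [hUa, hx a, Pi.add_apply, Pi.single_eq_of_ne h,
        add_zero]
  have hUker : ∀ {a b : V} (α : a ⟶ b), U a ≤ LinearMap.ker (x.1 α).mulVecLin := by
    intro a b α u hu
    have : U a ≤ x.1.socSpace a := sup_le (hsq.imSpace_le_socSpace a)
      ((Submodule.span_singleton_le_iff_mem _ _).2 (hmsoc a))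
    exact mem_socSpace.1 (this hu) b α
  have hUq : ∀ a, Module.finrank K ((Fin (d a) → K) ⧸ U a) =
      d a - s a - (Pi.single v 1 : V → ℕ) a := fun a => by
    have := (U a).finrank_quotient_add_finrank
    rw [hU, Module.finrank_pi, Fintype.card_fin, Pi.add_apply] at this
    omega
  -- The room at `v` forces a linear relation among the arrows into `v` that is nontrivial modulo
  -- `U`.
  obtain ⟨η', hη'U, u₀, hu₀, hη'⟩ := x.1.exists_functional v U hUker (by
    rw [hx v]
    simp only [hUq]
    exact hs)
  let η : ∀ {a b : V}, (a ⟶ b) → ((Fin (d a) → K) →ₗ[K] K) := fun {a b} α =>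
    if h : b = v then η' a (h ▸ α) else 0
  have hηv : ∀ {a : V} (α : a ⟶ v), η α = η' a α := fun α => dif_pos rfl
  have hηU : ∀ {a b : V} (α : a ⟶ b) u, u ∈ U a → η α u = 0 := by
    intro a b α u hu
    by_cases h : b = v
    · subst h
      rw [hηv]
      exact hη'U a α u hu
    · simp [η, h]
  -- The perturbation has values in the line of `m` and vanishes on `U`. Along the whole curve
  -- images stay in `U` and `U` is killed, so compositions remain zero.
  let y : RepSpace K d := fun a b α => LinearMap.toMatrix' ((η α).smulRight (m' b))
  have hy : ∀ {a b : V} (α : a ⟶ b) u, y α *ᵥ u = η α u • m' b := fun α u => by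
    rw [← Matrix.toLin'_apply]; simp [y]
  let F : K → RepSpace K d := fun t a b α => x.1 α + t • y α
  have hFu : ∀ t {a b : V} (α : a ⟶ b) u, F t α *ᵥ u = x.1 α *ᵥ u + (t * η α u) • m' b := by
    intro t a b α u
    simp only [F, add_mulVec, smul_mulVec, hy, smul_smul]
  have hFU : ∀ t {a b : V} (α : a ⟶ b) u, F t α *ᵥ u ∈ U b := by
    intro t a b α u
    rw [hFu]
    exact Submodule.add_mem_sup (x.1.mulVec_mem_imSpace α u)
      (Submodule.smul_mem _ _ (Submodule.mem_span_singleton_self _))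
  have hF : ∀ t, (F t).SqZero := by
    intro t a b c α β
    refine Matrix.toLin'.injective (LinearMap.ext fun u => ?_)
    have h1 : x.1 β *ᵥ (F t α *ᵥ u) = 0 := hUker β (hFU t α u)
    rw [Matrix.toLin'_apply, ← mulVec_mulVec, hFu, h1, hηU β _ (hFU t α u)]
    simp
  have him : ∀ t, t ≠ 0 → ∀ b, (F t).imSpace b = U b := by
    intro t ht b
    refine le_antisymm (imSpace_le fun a α u => hFU t α u) ?_
    have hmem : m' b ∈ (F t).imSpace b := by
      by_cases h : b = v
      · subst h
        -- On the relation `u₀` the contributions of `x` cancel, leaving a multiple of `m` that is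
        -- nonzero for `t ≠ 0`.
        have h3 : ∑ p : (Σ a, a ⟶ b), F t p.2 *ᵥ u₀ p =
            (t * ∑ p : (Σ a, a ⟶ b), η' p.1 p.2 (u₀ p)) • m' b := by
          simp only [hFu, Finset.sum_add_distrib, hu₀, zero_add, hηv]
          rw [← Finset.sum_smul, ← Finset.mul_sum]
        refine (Submodule.smul_mem_iff _ (mul_ne_zero ht hη')).1 ?_
        rw [← h3]
        exact Submodule.sum_mem _ fun p _ => (F t).mulVec_mem_imSpace _ _
      · rw [hmne b h]; exact zero_mem _
    refine sup_le (imSpace_le fun a α u => ?_) ((Submodule.span_singleton_le_iff_mem _ _).2 hmem)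
    rw [← add_sub_cancel_right (x.1 α *ᵥ u) ((t * η α u) • m' b), ← hFu]
    exact sub_mem ((F t).mulVec_mem_imSpace _ _) (Submodule.smul_mem _ _ hmem)
  have hcurve : π.IsPolyCurve fun t => π.repOfSqZero (F t) (hF t) := by
    refine ⟨fun a b α => (x.1 α).map C + (X : K[X]) • (y α).map C, fun t a b α => ?_⟩
    change F t α = _
    ext i j
    simp only [F, Matrix.map_apply, Matrix.add_apply, Matrix.smul_apply, smul_eq_mul,
      Polynomial.eval_add, Polynomial.eval_mul, Polynomial.eval_C, Polynomial.eval_X]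
  have h0 : π.repOfSqZero (F 0) (hF 0) = x := by
    refine Subtype.ext ?_
    funext a b α
    change F 0 α = x.1 α
    simp [F]
  rw [← h0]
  refine hcurve.mem_of_infinite isClosed_closure ?_ 0
  refine (Set.finite_singleton (0 : K)).infinite_compl.mono fun t ht => subset_closure fun a => ?_
  change Module.finrank K ((F t).imSpace a) = _
  rw [him t ht, hU]

end AdmissiblePresentation

end

/-! ### Irreducible components and the equivalence. -/

noncomputable section

namespace AdmissiblePresentation

open RepSpace

variable {K : Type u} [Field K] {V : Type v} [Quiver.{w} V] [Fintype V] [DecidableEq V]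
  [∀ a b : V, Fintype (a ⟶ b)]
  {Λ : Type u₁} [Ring Λ] [Algebra K Λ] (π : AdmissiblePresentation K V Λ) {d : V → ℕ}
variable (hJ : Ring.jacobson Λ ^ 2 = ⊥)

theorem dimVec_top_repModule (x : π.RepVariety d) (hJ : Ring.jacobson Λ ^ 2 = ⊥) (a : V) :
    π.dimVec (π.RepModule x ⧸ radModule Λ (π.RepModule x)) a =
      d a - Module.finrank K (x.1.imSpace a) := by
  rw [← π.dimVec_radModule_repModule hJ x, ← π.dimVec_repModule x a,
    ← π.dimVec_quotient_add (radModule Λ (π.RepModule x)), Nat.add_sub_cancel]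

include hJ in
theorem finrank_imSpace_le_sum (x : π.RepVariety d) (b : V) :
    Module.finrank K (x.1.imSpace b) ≤
      ∑ a, Fintype.card (a ⟶ b) * (d a - Module.finrank K (x.1.imSpace a)) := by
  have := finite_quotient (K := K) (radModule Λ (π.RepModule x))
  have h := (π.dimVec_radModule_le hJ (π.RepModule x) b).2
  rw [π.dimVec_radModule_repModule hJ] at h
  simpa only [π.dimVec_top_repModule x hJ] using h

/-- The vector `s + δ_v` is at most the radical dimension vector of the projective module whose
top has dimension vector `d - s - δ_v`. -/
def HasRoom (d s : V → ℕ) (v : V) : Prop :=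
  ∀ b, s b + (Pi.single v 1 : V → ℕ) b ≤
    ∑ a, Fintype.card (a ⟶ b) * (d a - s a - (Pi.single v 1 : V → ℕ) a)

include hJ in
/-- The module-theoretic condition on simple direct summands in terms of a point of `Rep_d(Λ)`. -/
theorem forall_not_embedsInto_iff {M : Type*} [AddCommGroup M] [Module K M] [Module Λ M]
    [IsScalarTower K Λ M] {x : π.RepVariety d} (e : M ≃ₗ[Λ] π.RepModule x) :
    (∀ M' S : Submodule Λ M, IsCompl M' S → IsSimpleModule Λ S →
      ∀ (P' : Type u₁) [AddCommGroup P'] [Module Λ P'] (f : P' →ₗ[Λ] M'),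
        IsProjectiveCover f → ¬ EmbedsInto Λ (radModule Λ M × S) (radModule Λ P')) ↔
    ∀ v, ¬ x.1.socSpace v ≤ x.1.imSpace v →
      ¬ HasRoom d (fun a => Module.finrank K (x.1.imSpace a)) v := by
  have hfin : Module.Finite K M := Module.Finite.equiv (e.restrictScalars K).symm
  have hrad : ∀ a, π.dimVec (radModule Λ M) a = Module.finrank K (x.1.imSpace a) := fun a => by
    rw [← π.dimVec_radModule_repModule hJ x]
    exact π.dimVec_congr (radModuleEquiv e) a
  have htop : ∀ a, π.dimVec (M ⧸ radModule Λ M) a = d a - Module.finrank K (x.1.imSpace a) :=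
    fun a => by
      rw [← π.dimVec_top_repModule x hJ]
      exact π.dimVec_congr (Submodule.Quotient.equiv _ _ e
        (map_radModule_of_surjective e.toLinearMap e.surjective)) a
  constructor
  · intro h v hv hroom
    obtain ⟨u, hu, hu'⟩ := Set.not_subset.1 hv
    have hmem : e.symm (π.ofVertex x v u) ∈ π.vertexSpace M v :=
      π.map_mem_vertexSpace e.symm.toLinearMap (π.ofVertex_mem x v u)
    have hkill : ∀ (b : V) (α : v ⟶ b), π.arrow α • e.symm (π.ofVertex x v u) = 0 := by
      intro b α
      rw [← map_smul, arrow_smul_ofVertex, mem_socSpace.1 hu, map_zero, map_zero]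
    have hnr : e.symm (π.ofVertex x v u) ∉ radModule Λ M := by
      intro hr
      have := map_mem_radModule e.toLinearMap hr
      rw [LinearEquiv.coe_toLinearMap, LinearEquiv.apply_symm_apply,
        π.ofVertex_mem_radModule hJ] at this
      exact hu' this
    obtain ⟨N, S, hNS, hS, P, _, _, f, hf, hemb⟩ := π.exists_embedsInto hJ hmem hkill hnr (by
      simp only [hrad, htop]
      exact hroom)
    exact h N S hNS hS P f hf hemb
  · intro h N S hNS hS P _ _ f hf hemb
    obtain ⟨v, m, hm, hkill, hr, hd⟩ := π.exists_of_embedsInto hJ hNS hf hemb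
    simp only [hrad, htop] at hd
    refine h v (fun hle => hr ?_) hd
    have hem := π.eq_ofVertex x (π.map_mem_vertexSpace e.toLinearMap hm)
    have hsoc : π.toVec x (e m) v ∈ x.1.socSpace v := by
      refine mem_socSpace.2 fun b α => ?_
      have h1 := congrArg e (hkill v b α)
      rw [map_smul, map_zero] at h1
      have h2 := congrFun (congrArg (π.toVec x) h1) b
      rwa [toVec_arrow_smul, Pi.single_eq_same, map_zero] at h2
    have h3 := (π.ofVertex_mem_radModule hJ x).2 (hle hsoc)
    have h4 := map_mem_radModule e.symm.toLinearMap h3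
    change e.symm (π.ofVertex x v (π.toVec x (e m) v)) ∈ _ at h4
    have h5 : e m = π.ofVertex x v (π.toVec x (e m) v) := hem
    rwa [← h5, LinearEquiv.symm_apply_apply] at h4

include hJ in
theorem isIrreducible_closure_stratum [Infinite K] {s : V → ℕ}
    (hs : (π.stratum s : Set (π.RepVariety d)).Nonempty) :
    IsIrreducible (closure (π.stratum s : Set (π.RepVariety d))) :=
  isIrreducible_iff_closure.2 ⟨hs, π.isPreirreducible_stratum hJ s⟩

theorem finrank_imSpace_le_of_mem_closure {s : V → ℕ} {x : π.RepVariety d}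
    (hx : x ∈ closure (π.stratum s)) (a : V) : Module.finrank K (x.1.imSpace a) ≤ s a :=
  closure_minimal (fun _ hy => (hy a).le) (π.isClosed_finrank_imSpace_le a (s a)) hx

include hJ in
-- On the stratum the socle space contains the image space, and a lower bound on socle dimensions
-- passes to the closure.
theorem le_finrank_socSpace_of_mem_closure {s : V → ℕ} {x : π.RepVariety d}
    (hx : x ∈ closure (π.stratum s)) (a : V) : s a ≤ Module.finrank K (x.1.socSpace a) :=
  closure_minimal (fun y hy => (hy a).ge.trans
    (Submodule.finrank_mono ((π.sqZero hJ y).imSpace_le_socSpace a)))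
    (π.isClosed_le_finrank_socSpace a (s a)) hx

include hJ in
/-- A stratum is dense in an irreducible component if and only if it contains a point whose simple
direct summands cannot be absorbed into the radical. -/
theorem closure_stratum_mem_irreducibleComponents_iff [Infinite K] (s : V → ℕ) :
    closure (π.stratum s) ∈ irreducibleComponents (π.RepVariety d) ↔
      ∃ x ∈ (π.stratum s : Set (π.RepVariety d)), ∀ v, ¬ x.1.socSpace v ≤ x.1.imSpace v →
        ¬ HasRoom d s v := by
  classical
  constructor
  · intro hcomp
    by_contra! hneg
    have hirr : IsIrreducible (π.stratum s : Set (π.RepVariety d)) :=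
      isIrreducible_iff_closure.1 hcomp.prop
    -- On the stratum, `D v` is the closed locus where a simple summand at `v` splits off. These
    -- loci, for `v` with room, cover the stratum; by irreducibility one of them contains it.
    let D : V → Set (π.RepVariety d) := fun v =>
      {x | s v + 1 ≤ Module.finrank K (x.1.socSpace v)}
    let B : Finset (Set (π.RepVariety d)) := (Finset.univ.filter (HasRoom d s)).image D
    obtain ⟨_, hz, hsub⟩ := isIrreducible_iff_sUnion_isClosed.1 hirr B
      (by
        intro z hz
        obtain ⟨v, -, rfl⟩ := Finset.mem_image.1 hz
        exact π.isClosed_le_finrank_socSpace v (s v + 1))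
      (by
        intro x hx
        obtain ⟨v, hv, hroom⟩ := hneg x hx
        refine ⟨D v, Finset.mem_coe.2 (Finset.mem_image.2
          ⟨v, Finset.mem_filter.2 ⟨Finset.mem_univ _, hroom⟩, rfl⟩), ?_⟩
        have h1 := Submodule.finrank_lt_finrank_of_lt (lt_of_le_not_ge
          ((π.sqZero hJ x).imSpace_le_socSpace v) hv)
        rwa [hx v] at h1)
    obtain ⟨v, hv, rfl⟩ := Finset.mem_image.1 hz
    have hroom := (Finset.mem_filter.1 hv).2
    have hcl : closure (π.stratum s) ⊆
        closure (π.stratum (s + Pi.single v 1) : Set (π.RepVariety d)) := by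
      refine closure_minimal (fun x hx => ?_) isClosed_closure
      have hns : ¬ x.1.socSpace v ≤ x.1.imSpace v := fun h => by
        have h1 := Submodule.finrank_mono h
        have h2 : s v + 1 ≤ _ := hsub hx
        rw [hx v] at h1
        omega
      obtain ⟨m, hm, hm'⟩ := Set.not_subset.1 hns
      refine π.mem_closure_stratum hJ hx hm hm' ?_
      simpa using hroom v
    have hne : (π.stratum (s + Pi.single v 1) : Set (π.RepVariety d)).Nonempty :=
      closure_nonempty_iff.1 (hcomp.prop.nonempty.mono hcl)
    -- Maximality would put stratum `s + δ_v` into the closure of stratum `s`, where the image at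
    -- `v` has dimension at most `s v`.
    have hle := hcomp.le_of_ge (π.isIrreducible_closure_stratum hJ hne) hcl
    obtain ⟨y, hy⟩ := hne
    have h1 := π.finrank_imSpace_le_of_mem_closure (hle (subset_closure hy)) v
    rw [hy v, Pi.add_apply, Pi.single_eq_same] at h1
    omega
  · rintro ⟨x, hx, hns⟩
    refine ⟨π.isIrreducible_closure_stratum hJ ⟨x, hx⟩, fun Z hZ hsZ => ?_⟩
    have hbound : ∀ (y : π.RepVariety d) (a : V), Module.finrank K (y.1.imSpace a) ≤ d a :=
      fun y a => (Submodule.finrank_le _).trans_eq (by rw [Module.finrank_pi, Fintype.card_fin])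
    -- Finitely many closures of strata cover the variety, so the irreducible set `Z` lies in one of
    -- them.
    obtain ⟨_, hz, hsub⟩ := isIrreducible_iff_sUnion_isClosed.1 hZ
      ((Finset.Iic d).image fun s' => closure (π.stratum s'))
      (by
        intro z hz
        obtain ⟨s', -, rfl⟩ := Finset.mem_image.1 hz
        exact isClosed_closure)
      (by
        intro y _
        exact ⟨closure (π.stratum fun a => Module.finrank K (y.1.imSpace a)),
          Finset.mem_coe.2 (Finset.mem_image.2 ⟨_, Finset.mem_Iic.2 (hbound y), rfl⟩),
          subset_closure fun _ => rfl⟩)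
    obtain ⟨s', -, rfl⟩ := Finset.mem_image.1 hz
    have hxcl : x ∈ closure (π.stratum s') := hsub (hsZ (subset_closure hx))
    have hle : s ≤ s' := fun a => (hx a).ge.trans (π.finrank_imSpace_le_of_mem_closure hxcl a)
    suffices s' = s by rwa [← this]
    by_contra hne
    obtain ⟨v, hv⟩ : ∃ v, s v < s' v := by
      by_contra! h
      exact hne (le_antisymm h hle)
    -- The socle of `x` at `v` has dimension at least `s' v > s v`, so a simple summand splits off
    -- there. Room comes from any point of stratum `s'`: its radical is bounded through its top `d -
    -- s'`, which is at most `d - s - δ_v`.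
    refine hns v (fun h => ?_) fun b => ?_
    · have h1 := Submodule.finrank_mono h
      have h2 := π.le_finrank_socSpace_of_mem_closure hJ hxcl v
      rw [hx v] at h1
      omega
    · have hadd : ∀ a, s a + (Pi.single v 1 : V → ℕ) a ≤ s' a := fun a => by
        by_cases h : a = v
        · subst h; rw [Pi.single_eq_same]; exact hv
        · rw [Pi.single_eq_of_ne h]; exact hle a
      obtain ⟨y, hy⟩ := closure_nonempty_iff.1 ⟨x, hxcl⟩
      have h1 := π.finrank_imSpace_le_sum hJ y b
      simp only [hy _] at h1
      refine ((hadd b).trans h1).trans (Finset.sum_le_sum fun a _ => Nat.mul_le_mul_left _ ?_)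
      have := hadd a
      omega

/-- A finite family of coordinates in `K` has a copy in the universe of `K`, where the module of
condition (b) is sought. -/
instance small_repModule (x : π.RepVariety d) : Small.{u} (π.RepModule x) :=
  inferInstanceAs (Small.{u} (VecSpace K d))

end AdmissiblePresentation

end

theorem proposition3p9 {K : Type u} [Field K] [IsAlgClosed K]
    {V : Type v} [Quiver.{w} V] [Fintype V] [DecidableEq V] [∀ a b : V, Finite (a ⟶ b)]
    {Λ : Type u} [Ring Λ] [Algebra K Λ] (π : AdmissiblePresentation K V Λ)
    (hJ : Ring.jacobson Λ ^ 2 = ⊥) (d : V → ℕ)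
    (T : Type u) [AddCommGroup T] [Module Λ T] [Module.Finite Λ T] [IsSemisimpleModule Λ T] :
    π.IsGenericTop d T ↔
      ∃ (M : Type u) (_ : AddCommGroup M) (_ : Module K M) (_ : Module Λ M)
        (_ : IsScalarTower K Λ M),
        Module.Finite Λ M ∧ HasTop Λ M T ∧ π.dimVec M = d ∧
          ∀ M' S : Submodule Λ M, IsCompl M' S → IsSimpleModule Λ S →
            ∀ (P' : Type u) [AddCommGroup P'] [Module Λ P'] (f : P' →ₗ[Λ] M'),
              IsProjectiveCover f →
                ¬ EmbedsInto Λ (radModule Λ M × S) (radModule Λ P') := by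
  classical
  let _ : ∀ a b : V, Fintype (a ⟶ b) := fun a b => Fintype.ofFinite _
  let _ : Module K T := Module.compHom T (algebraMap K Λ)
  have : IsScalarTower K Λ T := ⟨fun c r p => by rw [Algebra.smul_def, mul_smul]; rfl⟩
  have : Infinite K := IsAlgClosed.instInfinite
  have hΛ := π.module_finite hJ
  have : Module.Finite K T := Module.Finite.trans Λ T
  have hmem : ∀ x : π.RepVariety d, x ∈ π.repTop d T ↔
      ∀ a, π.dimVec T a + Module.finrank K (x.1.imSpace a) = d a := fun x =>
    π.hasTop_repModule_iff hJ x T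
  -- `T` fixes the dimension vector of the radical, so one point of `Rep_d^T` identifies it with a
  -- whole stratum.
  have hstratum : ∀ x ∈ π.repTop d T,
      π.repTop d T = π.stratum fun a => Module.finrank K (x.1.imSpace a) := by
    intro x hx
    ext y
    rw [hmem]
    refine forall_congr' fun a => ?_
    have := (hmem x).1 hx a
    change _ ↔ Module.finrank K (y.1.imSpace a) = Module.finrank K (x.1.imSpace a)
    omega
  have hgen : ∀ x ∈ π.repTop d T, π.IsGenericTop d T ↔ ∃ y ∈ π.repTop d T, ∀ v,
      ¬ y.1.socSpace v ≤ y.1.imSpace v →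
        ¬ AdmissiblePresentation.HasRoom d (fun a => Module.finrank K (y.1.imSpace a)) v := by
    intro x hx
    rw [AdmissiblePresentation.IsGenericTop, hstratum x hx,
      π.closure_stratum_mem_irreducibleComponents_iff hJ]
    refine exists_congr fun y => and_congr_right fun hy => ?_
    have : (fun a => Module.finrank K (y.1.imSpace a)) =
      fun a => Module.finrank K (x.1.imSpace a) := funext hy
    rw [this]
  constructor
  · intro h
    -- Irreducible components are nonempty, so some point has top `T`.
    obtain ⟨x, hx⟩ := closure_nonempty_iff.1 h.prop.nonempty
    obtain ⟨y, hy, hroom⟩ := (hgen x hx).1 h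
    let e : Shrink.{u} (π.RepModule y) ≃ₗ[Λ] π.RepModule y := Shrink.linearEquiv Λ _
    have : IsScalarTower K Λ (Shrink.{u} (π.RepModule y)) :=
      ⟨fun c r m => (equivShrink (π.RepModule y)).symm.injective (by
        simp only [equivShrink_symm_smul, smul_assoc])⟩
    obtain ⟨eT⟩ := hy
    refine ⟨Shrink.{u} (π.RepModule y), inferInstance, inferInstance, inferInstance, inferInstance,
      ?_, ?_, ?_, (π.forall_not_embedsInto_iff hJ e).2 hroom⟩
    · have : Module.Finite Λ (π.RepModule y) := Module.Finite.of_restrictScalars_finite K Λ _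
      exact Module.Finite.equiv e.symm
    · exact ⟨(Submodule.Quotient.equiv _ _ e
        (map_radModule_of_surjective e.toLinearMap e.surjective)).trans eT⟩
    · funext a
      rw [π.dimVec_congr e, π.dimVec_repModule]
  · rintro ⟨M, _, _, _, _, hfin, ⟨eT⟩, hd, hM⟩
    have : Module.Finite K M := Module.Finite.trans Λ M
    obtain ⟨x, ⟨e⟩⟩ := π.exists_repModule_equiv hJ M hd
    have hx : x ∈ π.repTop d T := ⟨(Submodule.Quotient.equiv _ _ e
      (map_radModule_of_surjective e.toLinearMap e.surjective)).symm.trans eT⟩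
    exact (hgen x hx).2 ⟨x, hx, (π.forall_not_embedsInto_iff hJ e).1 hM⟩
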